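/- Let $n,p$ be positive integers, $m=2p$, $J=\begin{bmatrix}0&I_p\\ I_p&0\end{bmatrix}$, and let $D=\mathrm{diag}\{d_1,\dots,d_p\}$ be a real diagonal matrix with $\det D\ne0$; put $|D|=\mathrm{diag}\{|d_1|,\dots,|d_p|\}$ and $H_0=\begin{bmatrix}D/2\\ I_p\end{bmatrix}\begin{bmatrix}D/2& I_p\end{bmatrix}$. Let $\alpha$ be a complex $n\times n$ matrix and $\Lambda_1(0),\Lambda_2(0)$ complex $n\times p$ matrices such that, with $\Lambda(0)=[\Lambda_1(0)\ \ \Lambda_2(0)]$, $$\alpha-\alpha^*=i\Lambda(0)J\Lambda(0)^*.$$ On $[0,\infty)$ define $\Lambda=[\Lambda_1\ \ \Lambda_2]$, $\Psi_1,\Psi_2$, $\Sigma$, $q_0$, $v_0$ by $$\Lambda'=-i\alpha\Lambda JH_0\ \ (\text{with the given value }\Lambda(0)),\qquad \Psi_1=\Lambda\begin{bmatrix}I_p\\ D/2\end{bmatrix},\quad \Psi_2=\Lambda\begin{bmatrix}I_p\\ -D/2\end{bmatrix},\qquad \Sigma'=\Psi_1\Psi_1^*,\ \ \Sigma(0)=I_n,$$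 $$q_0=J\Lambda^*\Sigma^{-1}\Lambda JH_0-JH_0J\Lambda^*\Sigma^{-1}\Lambda,\qquad v_0'=-q_0v_0,\ \ v_0(0)=I_m,$$ and put $H(x)=v_0(x)^*H_0v_0(x)$. Let $w(x,z)$ be the fundamental solution of the canonical system $w'=izJH(x)w$ $(x\ge0)$, $w(0,z)=I_m$. For $S\subseteq\mathbb C_+=\{z:\Im z>0\}$, a $p\times p$ matrix function $\varphi$ is called a Weyl function of this system on $S$ if it is holomorphic (complex differentiable at every point relative to $S$) on $S$ and $$\int_0^\infty\begin{bmatrix}I_p& i\varphi(z)^*\end{bmatrix}w(x,z)^*H(x)w(x,z)\begin{bmatrix}I_p\\ -i\varphi(z)\end{bmatrix}dx<\infty\qquad(z\in S);$$ it is called a Weyl function if this holds with $S=\mathbb C_+$. Put $$\gamma=\alpha-i\Psi_2\Lambda_2(0)^*,\qquad \widehat\Psi_1(0)=\Lambda_1(0)-\tfrac12\Lambda_2(0)|D|,\quad \widehat\Psi_2=\Lambda_1(0)+\tfrac12\Lambda_2(0)|D|,\quad \widehat\gamma=\alpha-i\widehat\Psi_2\Lambda_2(0)^*,$$ where $\Psi_2=\Lambda_1(0)-\frac12\Lambda_2(0)D$,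 and $$\varphi(z)=-\tfrac i2D+\Psi_1(0)^*(\gamma-zI_n)^{-1}\Psi_2,\qquad \widehat\varphi(z)=\tfrac i2|D|+\widehat\Psi_1(0)^*(\widehat\gamma-zI_n)^{-1}\widehat\Psi_2 .$$ Then: 1. $\Psi_1(0)=\Lambda_1(0)+\frac12\Lambda_2(0)D$, and $\Psi_2(x)\equiv\Lambda_1(0)-\frac12\Lambda_2(0)D$ for $x\ge0$. 2. $\varphi$ is a Weyl function on $\mathbb C_+\setminus\sigma(\gamma)$, that is, in $\mathbb C_+$ apart from the finitely many points of $\sigma(\gamma)$. The matrix $\widehat\gamma$ has no eigenvalues in $\mathbb C_+$, and $\widehat\varphi$ is a Weyl function (on the whole of $\mathbb C_+$). 3. If $D<0$, then $\varphi=\widehat\varphi$, $\sigma(\gamma)\cap\mathbb C_+=\emptyset$ (so $\varphi$ has no singularities in $\mathbb C_+$), $\varphi$ is a Weyl function, and it is the only one; moreover any Weyl function on a subset $S\subseteq\mathbb C_+$ coincides with $\varphi$ on $S$. 4. The matrices $\gamma,\widehat\gamma$ satisfy $$\gamma-\gamma^*=i\Lambda_2(0)D\Lambda_2(0)^*,\qquad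 \widehat\gamma^*-\widehat\gamma=i\big(\widehat\Psi_2-\widehat\Psi_1(0)\big)|D|^{-1}\big(\widehat\Psi_2-\widehat\Psi_1(0)\big)^*.$$ -/

import Mathlib

open scoped Matrix
open Set MeasureTheory

namespace CanonicalSystem

/-! ### Linear initial value problems on `[0, ∞)`

Existence and uniqueness, so that "the solution" of a linear initial value problem makes sense. -/

theorem linear_exists {E : Type*} [NormedAddCommGroup E] [NormedSpace ℝ E] [CompleteSpace E]
    (A : ℝ → E →L[ℝ] E) (hA : Continuous A) (u₀ : E) :
    ∃ u : ℝ → E, u 0 = u₀ ∧ ∀ x, HasDerivAt u (A x (u x)) x := by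
  let U : ℕ → ℝ → E := fun k => Nat.rec (fun _ => u₀) (fun _ f x => ∫ t in (0:ℝ)..x, A t (f t)) k
  have hU0 : ∀ x, U 0 x = u₀ := fun x => rfl
  have hUs : ∀ k x, U (k+1) x = ∫ t in (0:ℝ)..x, A t (U k t) := fun k x => rfl
  have hc : ∀ k, Continuous (U k) := by
    intro k
    induction k with
    | zero => exact continuous_const
    | succ k ih =>
      exact intervalIntegral.continuous_primitive
        (fun a b => (hA.clm_apply ih).intervalIntegrable a b) 0
  have hd : ∀ k x, HasDerivAt (U (k+1)) (A x (U k x)) x := fun k x =>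
    intervalIntegral.integral_hasDerivAt_right ((hA.clm_apply (hc k)).intervalIntegrable _ _)
      ((hA.clm_apply (hc k)).stronglyMeasurableAtFilter _ _)
      (hA.clm_apply (hc k)).continuousAt
  let V : ℕ → ℝ → E := fun k x => Nat.rec 0 (fun j _ => A x (U j x)) k
  have hV : ∀ k x, HasDerivAt (U k) (V k x) x := by
    intro k x
    cases k with
    | zero => exact hasDerivAt_const x u₀
    | succ k => exact hd k x
  have hbound : ∀ T : ℝ, ∃ M : ℝ, 0 ≤ M ∧ ∀ t ∈ Icc (-T) T, ‖A t‖ ≤ M := by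
    intro T
    obtain ⟨M, hM⟩ := (isCompact_Icc (a := -T) (b := T)).exists_bound_of_continuousOn
      hA.continuousOn
    exact ⟨max M 0, le_max_right _ _, fun t ht => (hM t ht).trans (le_max_left _ _)⟩
  have hmain : ∀ T : ℝ, 0 < T → ∀ x ∈ Ioo (-T) T, Summable (fun k => U k x) ∧
      HasDerivAt (fun y => ∑' k, U k y) (∑' k, V k x) x := by
    intro T hT x hx
    obtain ⟨M, hM0, hM⟩ := hbound T
    have hUb : ∀ k, ∀ t ∈ Ioo (-T) T, ‖U k t‖ ≤ ‖u₀‖ * (M ^ k * |t| ^ k / k.factorial) := by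
      intro k
      induction k with
      | zero => intro t _; simp [hU0]
      | succ k ih =>
        intro t ht
        have hsub : uIoc 0 t ⊆ Ioo (-T) T := by
          intro s hs
          rcases le_total 0 t with h | h
          · rw [uIoc_of_le h] at hs; exact ⟨by linarith [hs.1], by linarith [hs.2, ht.2]⟩
          · rw [uIoc_of_ge h] at hs; exact ⟨by linarith [hs.1, ht.1], by linarith [hs.2]⟩
        have hint : ∀ f : ℝ → ℝ, Continuous f → IntegrableOn f (uIoc 0 t) volume := fun f hf =>
          (hf.integrableOn_uIcc (a := 0) (b := t)).mono_set uIoc_subset_uIcc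
        rw [hUs]
        calc ‖∫ s in (0:ℝ)..t, A s (U k s)‖ ≤ ∫ s in uIoc 0 t, ‖A s (U k s)‖ :=
              intervalIntegral.norm_integral_le_integral_norm_uIoc
          _ ≤ ∫ s in uIoc 0 t, (‖u₀‖ * M ^ (k+1) / k.factorial) * |s - 0| ^ k := by
              apply setIntegral_mono_on (hint _ (hA.clm_apply (hc k)).norm)
                (hint _ (by fun_prop)) measurableSet_uIoc
              intro s hs
              have h1 := ih s (hsub hs)
              have h2 := hM s (Ioo_subset_Icc_self (hsub hs))
              calc ‖A s (U k s)‖ ≤ ‖A s‖ * ‖U k s‖ := (A s).le_opNorm _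
                _ ≤ M * (‖u₀‖ * (M ^ k * |s| ^ k / k.factorial)) := by gcongr
                _ = _ := by rw [sub_zero]; ring
          _ = _ := by
              rw [integral_const_mul, integral_pow_abs_sub_uIoc, sub_zero, Nat.factorial_succ]
              push_cast
              field_simp
    have hs0 : Summable (fun k : ℕ => ‖u₀‖ * (M ^ k * T ^ k / k.factorial)) := by
      apply Summable.mul_left
      simpa [mul_pow] using Real.summable_pow_div_factorial (M * T)
    have hs1 : Summable (fun k : ℕ => (Nat.rec 0
        (fun j _ => M * (‖u₀‖ * (M ^ j * T ^ j / j.factorial))) k : ℝ)) :=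
      (summable_nat_add_iff 1).1 (by simpa using hs0.mul_left M)
    have hb' : ∀ k, ∀ t ∈ Ioo (-T) T, ‖U k t‖ ≤ ‖u₀‖ * (M ^ k * T ^ k / k.factorial) := by
      intro k t ht
      refine (hUb k t ht).trans ?_
      have : |t| ≤ T := abs_le.2 ⟨ht.1.le, ht.2.le⟩
      gcongr
    have hVb : ∀ k, ∀ t ∈ Ioo (-T) T, ‖V k t‖ ≤ (Nat.rec 0
        (fun j _ => M * (‖u₀‖ * (M ^ j * T ^ j / j.factorial))) k : ℝ) := by
      intro k t ht
      cases k with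
      | zero => simp [V]
      | succ k =>
        calc ‖A t (U k t)‖ ≤ ‖A t‖ * ‖U k t‖ := (A t).le_opNorm _
          _ ≤ M * (‖u₀‖ * (M ^ k * T ^ k / k.factorial)) := by
            have h1 := hb' k t ht
            have h2 := hM t (Ioo_subset_Icc_self ht)
            gcongr
    exact ⟨Summable.of_norm_bounded hs0 (fun k => hb' k x hx),
      hasDerivAt_tsum_of_isPreconnected hs1 isOpen_Ioo isPreconnected_Ioo
        (fun k y _ => hV k y) hVb hx (Summable.of_norm_bounded hs0 (fun k => hb' k x hx)) hx⟩
  have hmain' : ∀ x, Summable (fun k => U k x) ∧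
      HasDerivAt (fun y => ∑' k, U k y) (∑' k, V k x) x := fun x =>
    hmain (|x| + 1) (by positivity) x
      ⟨by linarith [neg_abs_le x], by linarith [le_abs_self x]⟩
  refine ⟨fun x => ∑' k, U k x, ?_, fun x => ?_⟩
  · change ∑' k, U k 0 = u₀
    rw [tsum_eq_single 0]
    · exact hU0 0
    intro k hk
    obtain ⟨j, rfl⟩ := Nat.exists_eq_succ_of_ne_zero hk
    simp [hUs]
  · convert (hmain' x).2 using 1
    have h1 := (hmain' x).1
    have hsum : Summable (fun k => V (k+1) x) := (A x).summable (f := fun k => U k x) h1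
    have h2 : Summable (fun k => V k x) := (summable_nat_add_iff 1).1 hsum
    rw [h2.tsum_eq_zero_add, (A x).map_tsum h1]
    exact (zero_add _).symm

theorem linear_exists_Ici {E : Type*} [NormedAddCommGroup E] [NormedSpace ℝ E]
    [FiniteDimensional ℝ E] (F : ℝ → E →ₗ[ℝ] E)
    (hF : ∀ M, ContinuousOn (fun x => F x M) (Ici 0)) (u₀ : E) :
    ∃ u : ℝ → E, u 0 = u₀ ∧ ∀ x ∈ Ici (0:ℝ), HasDerivWithinAt u (F x (u x)) (Ici 0) x := by
  have : CompleteSpace E := FiniteDimensional.complete ℝ E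
  let A : ℝ → E →L[ℝ] E := fun x => LinearMap.toContinuousLinearMap (F (max x 0))
  have hA : Continuous A := by
    rw [continuous_clm_apply]
    intro M
    exact (hF M).comp_continuous (continuous_id.max continuous_const) (fun x => mem_Ici.2 (le_max_right x 0))
  obtain ⟨u, hu0, hu⟩ := linear_exists A hA u₀
  refine ⟨u, hu0, fun x hx => ?_⟩
  have h := (hu x).hasDerivWithinAt (s := Ici 0)
  have h1 : A x (u x) = F x (u x) := by
    change F (max x 0) (u x) = _
    rw [max_eq_left hx]
  rwa [h1] at h

theorem linear_unique_Ici {E : Type*} [NormedAddCommGroup E] [NormedSpace ℝ E]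
    [FiniteDimensional ℝ E] (F : ℝ → E →ₗ[ℝ] E)
    (hF : ∀ M, ContinuousOn (fun x => F x M) (Ici 0)) {u v : ℝ → E}
    (hu : ∀ x ∈ Ici (0:ℝ), HasDerivWithinAt u (F x (u x)) (Ici 0) x)
    (hv : ∀ x ∈ Ici (0:ℝ), HasDerivWithinAt v (F x (v x)) (Ici 0) x)
    (h0 : u 0 = v 0) : EqOn u v (Ici 0) := by
  let A : ℝ → E →L[ℝ] E := fun x => LinearMap.toContinuousLinearMap (F x)
  have hA : ContinuousOn A (Ici 0) := by
    rw [continuousOn_clm_apply]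
    exact hF
  intro T hT
  obtain ⟨K, hK⟩ := (isCompact_Icc (a := (0:ℝ)) (b := T)).exists_bound_of_continuousOn
    (hA.mono Icc_subset_Ici_self)
  have hc : ∀ w : ℝ → E, (∀ x ∈ Ici (0:ℝ), HasDerivWithinAt w (F x (w x)) (Ici 0) x) →
      ContinuousOn w (Icc 0 T) :=
    fun w hw x hx => ((hw x hx.1).continuousWithinAt).mono Icc_subset_Ici_self
  have hd : ∀ w : ℝ → E, (∀ x ∈ Ici (0:ℝ), HasDerivWithinAt w (F x (w x)) (Ici 0) x) →
      ∀ t ∈ Ico 0 T, HasDerivWithinAt w (F t (w t)) (Ici t) t :=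
    fun w hw t ht => (hw t ht.1).mono (Ici_subset_Ici.2 ht.1)
  refine ODE_solution_unique_of_mem_Icc_right (v := fun x M => F x M) (K := K.toNNReal)
    (s := fun _ => univ) (fun t ht => ?_) (hc u hu) (hd u hu) (fun _ _ => mem_univ _)
    (hc v hv) (hd v hv) (fun _ _ => mem_univ _) h0 (right_mem_Icc.2 hT)
  have h1 : LipschitzWith ‖A t‖₊ (A t) := (A t).lipschitz
  refine (h1.weaken ?_).lipschitzOnWith
  rw [← NNReal.coe_le_coe, coe_nnnorm]
  exact (hK t ⟨ht.1, ht.2.le⟩).trans (Real.le_coe_toNNReal _)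

/-- `u` solves the matrix initial value problem `u' = F(x, u)`, `u(0) = u₀` on `[0, ∞)`;
the derivative is taken entrywise, and one-sided at `x = 0`. -/
def IsSolution {m n : Type*} (F : ℝ → Matrix m n ℂ → Matrix m n ℂ) (u₀ : Matrix m n ℂ)
    (u : ℝ → Matrix m n ℂ) : Prop :=
  u 0 = u₀ ∧ ∀ x ∈ Ici (0 : ℝ), ∀ i j,
    HasDerivWithinAt (fun y => u y i j) (F x (u x) i j) (Ici 0) x

open Classical in
/-- The solution of the initial value problem `u' = F(x, u)`, `u(0) = u₀` on `[0, ∞)`. It is used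
only for linear `F` with continuous coefficients, where a solution exists and is unique on
`[0, ∞)` (`solution_spec`, `IsSolution.eqOn`). -/
noncomputable def solution {m n : Type*} (F : ℝ → Matrix m n ℂ → Matrix m n ℂ)
    (u₀ : Matrix m n ℂ) : ℝ → Matrix m n ℂ :=
  if h : ∃ u, IsSolution F u₀ u then h.choose else 0

theorem solution_spec {m n : Type*} [Fintype m] [Fintype n]
    (F : ℝ → Matrix m n ℂ →ₗ[ℝ] Matrix m n ℂ)
    (hF : ∀ M, ContinuousOn (fun x => F x M) (Ici 0)) (u₀ : Matrix m n ℂ) :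
    IsSolution (fun x M => F x M) u₀ (solution (fun x M => F x M) u₀) := by
  have h : ∃ u, IsSolution (fun x M => F x M) u₀ u := by
    obtain ⟨u, h0, hu⟩ := linear_exists_Ici (E := m → n → ℂ) F hF u₀
    exact ⟨u, h0, fun x hx i j => hasDerivWithinAt_pi.1 (hasDerivWithinAt_pi.1 (hu x hx) i) j⟩
  rw [solution, dif_pos h]
  exact h.choose_spec

theorem IsSolution.eqOn {m n : Type*} [Fintype m] [Fintype n]
    {F : ℝ → Matrix m n ℂ →ₗ[ℝ] Matrix m n ℂ}
    (hF : ∀ M, ContinuousOn (fun x => F x M) (Ici 0)) {u₀ : Matrix m n ℂ}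
    {u v : ℝ → Matrix m n ℂ} (hu : IsSolution (fun x M => F x M) u₀ u)
    (hv : IsSolution (fun x M => F x M) u₀ v) : EqOn u v (Ici 0) :=
  linear_unique_Ici (E := m → n → ℂ) F hF
    (fun x hx => hasDerivWithinAt_pi.2 fun i => hasDerivWithinAt_pi.2 fun j => hu.2 x hx i j)
    (fun x hx => hasDerivWithinAt_pi.2 fun i => hasDerivWithinAt_pi.2 fun j => hv.2 x hx i j)
    (hu.1.trans hv.1.symm)

theorem continuousOn_mul {l m n : Type*} [Fintype m] {s : Set ℝ} {A : ℝ → Matrix l m ℂ}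
    {B : ℝ → Matrix m n ℂ} (hA : ContinuousOn A s) (hB : ContinuousOn B s) :
    ContinuousOn (fun x => A x * B x) s :=
  continuousOn_iff_continuous_domRestrict.2
    (hA.domRestrict.matrix_mul hB.domRestrict)

theorem IsSolution.continuousOn {m n : Type*} {F : ℝ → Matrix m n ℂ → Matrix m n ℂ}
    {u₀ : Matrix m n ℂ} {u : ℝ → Matrix m n ℂ} (hu : IsSolution F u₀ u) :
    ContinuousOn u (Ici 0) :=
  continuousOn_pi.2 fun i => continuousOn_pi.2 fun j => fun x hx =>
    (hu.2 x hx i j).continuousWithinAt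

/-- The case `u' = A(x) u` with a continuous square matrix function `A`. -/
theorem solution_mul_spec {m n : Type*} [Fintype m] [Fintype n]
    {A : ℝ → Matrix m m ℂ} (hA : ContinuousOn A (Ici 0)) (u₀ : Matrix m n ℂ) :
    IsSolution (fun x M => A x * M) u₀ (solution (fun x M => A x * M) u₀) :=
  solution_spec (fun x => LinearMap.mk (AddHom.mk (fun M => A x * M) (fun a b => Matrix.mul_add _ a b))
    (fun r M => Matrix.mul_smul _ r M)) (fun _ => continuousOn_mul hA continuousOn_const) u₀

/-! ### Canonical systems and Weyl functions -/

/-- The `2p × 2p` matrix `J = [[0, I], [I, 0]]`. -/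
def J (p : ℕ) : Matrix (Fin p ⊕ Fin p) (Fin p ⊕ Fin p) ℂ := Matrix.fromBlocks 0 1 1 0

/-- The fundamental solution `w(x, z)` of the canonical system `w' = i z J H(x) w`, `x ≥ 0`,
normalized by `w(0, z) = I`. -/
noncomputable def fundamentalSolution {p : ℕ}
    (H : ℝ → Matrix (Fin p ⊕ Fin p) (Fin p ⊕ Fin p) ℂ) (z : ℂ) :
    ℝ → Matrix (Fin p ⊕ Fin p) (Fin p ⊕ Fin p) ℂ :=
  solution (fun x w => (Complex.I * z) • (J p * H x) * w) 1

/-- The open upper half-plane `ℂ₊`. -/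
def upperHalf : Set ℂ := {z | 0 < z.im}

/-- The `p × p` matrix function
`[I  iφ(z)^*] w(x, z)^* H(x) w(x, z) [I; -iφ(z)]` of `x`. -/
noncomputable def weylIntegrand {p : ℕ}
    (H : ℝ → Matrix (Fin p ⊕ Fin p) (Fin p ⊕ Fin p) ℂ) (φ : ℂ → Matrix (Fin p) (Fin p) ℂ)
    (z : ℂ) (x : ℝ) : Matrix (Fin p) (Fin p) ℂ :=
  (Matrix.fromCols 1 (Complex.I • (φ z)ᴴ) : Matrix (Fin p) (Fin p ⊕ Fin p) ℂ) *
    (fundamentalSolution H z x)ᴴ * H x *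
    fundamentalSolution H z x *
    (Matrix.fromRows 1 (-Complex.I • φ z) : Matrix (Fin p ⊕ Fin p) (Fin p) ℂ)

/-- `φ` is holomorphic on `S` and, at every `z ∈ S`, the integral over `[0, ∞)` of the
(entrywise) matrix function `weylIntegrand H φ z` is finite. -/
def IsWeylOn {p : ℕ} (H : ℝ → Matrix (Fin p ⊕ Fin p) (Fin p ⊕ Fin p) ℂ)
    (φ : ℂ → Matrix (Fin p) (Fin p) ℂ) (S : Set ℂ) : Prop :=
  (∀ i j, DifferentiableOn ℂ (fun z => φ z i j) S) ∧
    ∀ z ∈ S, ∀ i j, MeasureTheory.IntegrableOn (fun x => weylIntegrand H φ z x i j) (Ici 0)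

/-- `φ` is a Weyl function of the canonical system with Hamiltonian `H`: it is holomorphic in
`ℂ₊` and satisfies the integrability condition at every point of `ℂ₊`. -/
def IsWeylFunction {p : ℕ} (H : ℝ → Matrix (Fin p ⊕ Fin p) (Fin p ⊕ Fin p) ℂ)
    (φ : ℂ → Matrix (Fin p) (Fin p) ℂ) : Prop :=
  IsWeylOn H φ upperHalf

/-! ### The canonical system determined by the parameter matrices -/

/-- `D = diag{d₁, …, d_p}`. -/
def D {p : ℕ} (d : Fin p → ℝ) : Matrix (Fin p) (Fin p) ℂ := Matrix.diagonal fun i => (d i : ℂ)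

/-- `|D| = diag{|d₁|, …, |d_p|}`. -/
def absD {p : ℕ} (d : Fin p → ℝ) : Matrix (Fin p) (Fin p) ℂ :=
  Matrix.diagonal fun i => ((|d i| : ℝ) : ℂ)

/-- The Hamiltonian `H₀ = [D/2; I] [D/2  I]` of the initial system. -/
noncomputable def H₀ {p : ℕ} (d : Fin p → ℝ) :
    Matrix (Fin p ⊕ Fin p) (Fin p ⊕ Fin p) ℂ :=
  Matrix.fromRows ((1 / 2 : ℂ) • D d) 1 * Matrix.fromCols ((1 / 2 : ℂ) • D d) 1

section GBDT

variable {n p : ℕ} (d : Fin p → ℝ) (α : Matrix (Fin n) (Fin n) ℂ)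
  (Λ₁ Λ₂ : Matrix (Fin n) (Fin p) ℂ)

/-- `Λ(x)`: the solution of `Λ' = -i α Λ J H₀`, `Λ(0) = [Λ₁  Λ₂]`. -/
noncomputable def Lam : ℝ → Matrix (Fin n) (Fin p ⊕ Fin p) ℂ :=
  solution (fun _ L => -Complex.I • (α * L * J p * H₀ d)) (Matrix.fromCols Λ₁ Λ₂)

/-- `Ψ₁(x) = Λ(x) [I; D/2]`. -/
noncomputable def Psi₁ (x : ℝ) : Matrix (Fin n) (Fin p) ℂ :=
  Lam d α Λ₁ Λ₂ x * Matrix.fromRows 1 ((1 / 2 : ℂ) • D d)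

/-- `Ψ₂(x) = Λ(x) [I; -D/2]`. -/
noncomputable def Psi₂ (x : ℝ) : Matrix (Fin n) (Fin p) ℂ :=
  Lam d α Λ₁ Λ₂ x * Matrix.fromRows 1 (-(1 / 2 : ℂ) • D d)

/-- `Σ(x) = I + ∫₀ˣ Ψ₁(t) Ψ₁(t)^* dt` (entrywise), i.e. `Σ' = Ψ₁ Ψ₁^*`, `Σ(0) = I`. -/
noncomputable def Sig (x : ℝ) : Matrix (Fin n) (Fin n) ℂ :=
  1 + Matrix.of fun i j => ∫ t in (0 : ℝ)..x, (Psi₁ d α Λ₁ Λ₂ t * (Psi₁ d α Λ₁ Λ₂ t)ᴴ) i j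

/-- `q₀ = J Λ^* Σ⁻¹ Λ J H₀ - J H₀ J Λ^* Σ⁻¹ Λ`. -/
noncomputable def q₀ (x : ℝ) : Matrix (Fin p ⊕ Fin p) (Fin p ⊕ Fin p) ℂ :=
  J p * (Lam d α Λ₁ Λ₂ x)ᴴ * (Sig d α Λ₁ Λ₂ x)⁻¹ * Lam d α Λ₁ Λ₂ x * J p * H₀ d -
    J p * H₀ d * J p * (Lam d α Λ₁ Λ₂ x)ᴴ * (Sig d α Λ₁ Λ₂ x)⁻¹ * Lam d α Λ₁ Λ₂ x

/-- `v₀`: the solution of `v₀' = -q₀ v₀` with `v₀(0) = I`. -/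
noncomputable def v₀ : ℝ → Matrix (Fin p ⊕ Fin p) (Fin p ⊕ Fin p) ℂ :=
  solution (fun x v => -q₀ d α Λ₁ Λ₂ x * v) 1

/-- The Hamiltonian `H(x) = v₀(x)^* H₀ v₀(x)` of the canonical system determined by `α` and
`Λ(0) = [Λ₁  Λ₂]` (with `v₀(0) = I`). -/
noncomputable def Ham (x : ℝ) : Matrix (Fin p ⊕ Fin p) (Fin p ⊕ Fin p) ℂ :=
  (v₀ d α Λ₁ Λ₂ x)ᴴ * H₀ d * v₀ d α Λ₁ Λ₂ x

/-! The initial value problems above have (unique) solutions, so `Λ`, `v₀` and `w` are what they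
are meant to be. -/

theorem Lam_spec : IsSolution (fun _ L => -Complex.I • (α * L * J p * H₀ d))
    (Matrix.fromCols Λ₁ Λ₂) (Lam d α Λ₁ Λ₂) :=
  let F : Matrix (Fin n) (Fin p ⊕ Fin p) ℂ →ₗ[ℂ] Matrix (Fin n) (Fin p ⊕ Fin p) ℂ :=
    { toFun := fun L => -Complex.I • (α * L * J p * H₀ d)
      map_add' := fun a b => by simp only [Matrix.mul_add, Matrix.add_mul, smul_add]
      map_smul' := fun r M => by
        simp only [Matrix.mul_smul, Matrix.smul_mul, RingHom.id_apply]
        rw [smul_comm] }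
  solution_spec (fun _ => F.restrictScalars ℝ) (fun _ => continuousOn_const) _

theorem Psi₁_continuousOn : ContinuousOn (Psi₁ d α Λ₁ Λ₂) (Ici 0) :=
  continuousOn_mul (Lam_spec d α Λ₁ Λ₂).continuousOn continuousOn_const

theorem continuousOn_conjTranspose {l m : Type*} {s : Set ℝ} {A : ℝ → Matrix l m ℂ}
    (hA : ContinuousOn A s) : ContinuousOn (fun x => (A x)ᴴ) s :=
  continuousOn_iff_continuous_domRestrict.2 hA.domRestrict.matrix_conjTranspose

theorem Psi₁_mul_continuousOn :
    ContinuousOn (fun t => Psi₁ d α Λ₁ Λ₂ t * (Psi₁ d α Λ₁ Λ₂ t)ᴴ) (Ici 0) :=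
  continuousOn_mul (Psi₁_continuousOn d α Λ₁ Λ₂)
    (continuousOn_conjTranspose (Psi₁_continuousOn d α Λ₁ Λ₂))

theorem continuousOn_entry {l m : Type*} {s : Set ℝ} {A : ℝ → Matrix l m ℂ}
    (hA : ContinuousOn A s) (i : l) (j : m) : ContinuousOn (fun x => A x i j) s :=
  continuousOn_pi.1 (continuousOn_pi.1 hA i) j

theorem Psi₁_intervalIntegrable {x : ℝ} (hx : 0 ≤ x) (i j : Fin n) : IntervalIntegrable
    (fun t => (Psi₁ d α Λ₁ Λ₂ t * (Psi₁ d α Λ₁ Λ₂ t)ᴴ) i j) volume 0 x := by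
  apply ContinuousOn.intervalIntegrable
  rw [uIcc_of_le hx]
  exact (continuousOn_entry (Psi₁_mul_continuousOn d α Λ₁ Λ₂) i j).mono Icc_subset_Ici_self

open scoped ComplexOrder in
theorem Sig_posDef {x : ℝ} (hx : 0 ≤ x) : (Sig d α Λ₁ Λ₂ x).PosDef := by
  refine Matrix.PosDef.one.add_posSemidef (Matrix.PosSemidef.of_dotProduct_mulVec_nonneg ?_ ?_)
  · ext i j
    rw [Matrix.conjTranspose_apply, Matrix.of_apply, Matrix.of_apply]
    change (starRingEnd ℂ) _ = _
    rw [← intervalIntegral.intervalIntegral_conj]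
    congr 1
    ext t
    have := (Matrix.isHermitian_mul_conjTranspose_self (Psi₁ d α Λ₁ Λ₂ t)).apply i j
    exact this
  · intro v
    have h : star v ⬝ᵥ ((Matrix.of fun i j => ∫ t in (0 : ℝ)..x,
        (Psi₁ d α Λ₁ Λ₂ t * (Psi₁ d α Λ₁ Λ₂ t)ᴴ) i j) *ᵥ v) =
        ∫ t in (0 : ℝ)..x, star v ⬝ᵥ ((Psi₁ d α Λ₁ Λ₂ t * (Psi₁ d α Λ₁ Λ₂ t)ᴴ) *ᵥ v) := by
      simp only [dotProduct, Matrix.mulVec, Matrix.of_apply]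
      rw [intervalIntegral.integral_finsetSum]
      · refine Finset.sum_congr rfl fun i _ => ?_
        rw [intervalIntegral.integral_const_mul, intervalIntegral.integral_finsetSum]
        · congr 1
          refine Finset.sum_congr rfl fun j _ => ?_
          rw [intervalIntegral.integral_mul_const]
        · intro j _
          exact (Psi₁_intervalIntegrable d α Λ₁ Λ₂ hx i j).mul_const _
      · intro i _
        refine IntervalIntegrable.const_mul ?_ _
        have h := IntervalIntegrable.sum (μ := volume) (a := 0) (b := x) Finset.univ
          (f := fun j t => (Psi₁ d α Λ₁ Λ₂ t * (Psi₁ d α Λ₁ Λ₂ t)ᴴ) i j * v j) fun j _ =>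
          (Psi₁_intervalIntegrable d α Λ₁ Λ₂ hx i j).mul_const _
        rwa [Finset.sum_fn] at h
    rw [h]
    have h0 : ∀ t, (0 : ℂ) ≤ star v ⬝ᵥ ((Psi₁ d α Λ₁ Λ₂ t * (Psi₁ d α Λ₁ Λ₂ t)ᴴ) *ᵥ v) := fun t =>
      (Matrix.posSemidef_self_mul_conjTranspose (Psi₁ d α Λ₁ Λ₂ t)).dotProduct_mulVec_nonneg v
    have h1 := fun t => Complex.eq_re_of_ofReal_le (h0 t)
    rw [intervalIntegral.integral_congr fun t _ => h1 t, intervalIntegral.integral_ofReal]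
    exact Complex.zero_le_real.2
      (intervalIntegral.integral_nonneg hx fun t _ => (Complex.nonneg_iff.1 (h0 t)).1)

theorem Sig_spec : IsSolution (fun x _ => Psi₁ d α Λ₁ Λ₂ x * (Psi₁ d α Λ₁ Λ₂ x)ᴴ) 1
    (Sig d α Λ₁ Λ₂) := by
  refine ⟨by ext i j; simp [Sig], fun x hx i j => ?_⟩
  have hc := continuousOn_entry (Psi₁_mul_continuousOn d α Λ₁ Λ₂) i j
  have hx' : x ∈ Icc 0 (x + 1) := ⟨hx, by linarith⟩
  have hf : Fact (x ∈ Icc 0 (x + 1)) := ⟨hx'⟩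
  have hc' := hc.mono (Icc_subset_Ici_self : Icc 0 (x + 1) ⊆ Ici 0)
  have h := intervalIntegral.integral_hasDerivWithinAt_right (s := Icc 0 (x + 1))
    (Psi₁_intervalIntegrable d α Λ₁ Λ₂ hx i j)
    (hc'.stronglyMeasurableAtFilter_nhdsWithin measurableSet_Icc x) (hc' x hx')
  have hn : Icc 0 (x + 1) ∈ nhdsWithin x (Ici 0) := by
    rw [← Ici_inter_Iic]
    exact Filter.inter_mem self_mem_nhdsWithin
      (mem_nhdsWithin_of_mem_nhds (Iic_mem_nhds (by linarith)))
  exact (h.mono_of_mem_nhdsWithin hn).const_add ((1 : Matrix (Fin n) (Fin n) ℂ) i j)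

open scoped ComplexOrder in
theorem Sig_inv_continuousOn : ContinuousOn (fun x => (Sig d α Λ₁ Λ₂ x)⁻¹) (Ici 0) := by
  have h := (Sig_spec d α Λ₁ Λ₂).continuousOn
  have hdet : ContinuousOn (fun x => (Sig d α Λ₁ Λ₂ x).det) (Ici 0) :=
    continuousOn_iff_continuous_domRestrict.2 h.domRestrict.matrix_det
  have hadj : ContinuousOn (fun x => (Sig d α Λ₁ Λ₂ x).adjugate) (Ici 0) :=
    continuousOn_iff_continuous_domRestrict.2 h.domRestrict.matrix_adjugate
  simp only [Matrix.inv_def, Ring.inverse_eq_inv']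
  exact (hdet.inv₀ fun x hx => (Sig_posDef d α Λ₁ Λ₂ (mem_Ici.1 hx)).det_pos.ne').smul hadj

theorem q₀_continuousOn : ContinuousOn (q₀ d α Λ₁ Λ₂) (Ici 0) := by
  have h1 := (Lam_spec d α Λ₁ Λ₂).continuousOn
  have h2 := continuousOn_conjTranspose h1
  have h3 := Sig_inv_continuousOn d α Λ₁ Λ₂
  exact (continuousOn_mul (continuousOn_mul (continuousOn_mul (continuousOn_mul
      (continuousOn_mul continuousOn_const h2) h3) h1) continuousOn_const) continuousOn_const).sub
    (continuousOn_mul (continuousOn_mul (continuousOn_mul continuousOn_const h2) h3) h1)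

theorem v₀_spec : IsSolution (fun x v => -q₀ d α Λ₁ Λ₂ x * v) 1 (v₀ d α Λ₁ Λ₂) :=
  solution_mul_spec (q₀_continuousOn d α Λ₁ Λ₂).neg 1

theorem Ham_continuousOn : ContinuousOn (Ham d α Λ₁ Λ₂) (Ici 0) :=
  have h := (v₀_spec d α Λ₁ Λ₂).continuousOn
  continuousOn_mul (continuousOn_mul (continuousOn_conjTranspose h) continuousOn_const) h

theorem fundamentalSolution_spec {H : ℝ → Matrix (Fin p ⊕ Fin p) (Fin p ⊕ Fin p) ℂ}
    (hH : ContinuousOn H (Ici 0)) (z : ℂ) :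
    IsSolution (fun x w => (Complex.I * z) • (J p * H x) * w) 1 (fundamentalSolution H z) :=
  solution_mul_spec (A := fun x => (Complex.I * z) • (J p * H x))
    ((continuousOn_mul continuousOn_const hH).const_smul (Complex.I * z)) 1

/-! ### The explicit Weyl functions -/

/-- `Ψ₂ = Λ₁ - (1/2) Λ₂ D`. -/
noncomputable def Psi₂Const : Matrix (Fin n) (Fin p) ℂ := Λ₁ - (1 / 2 : ℂ) • (Λ₂ * D d)

/-- `Ψ₁(0) = Λ₁ + (1/2) Λ₂ D`. -/
noncomputable def Psi₁Zero : Matrix (Fin n) (Fin p) ℂ := Λ₁ + (1 / 2 : ℂ) • (Λ₂ * D d)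

/-- `Ψ̂₁(0) = Λ₁ - (1/2) Λ₂ |D|`. -/
noncomputable def PsiHat₁Zero : Matrix (Fin n) (Fin p) ℂ := Λ₁ - (1 / 2 : ℂ) • (Λ₂ * absD d)

/-- `Ψ̂₂ = Λ₁ + (1/2) Λ₂ |D|`. -/
noncomputable def PsiHat₂ : Matrix (Fin n) (Fin p) ℂ := Λ₁ + (1 / 2 : ℂ) • (Λ₂ * absD d)

/-- `γ = α - i Ψ₂ Λ₂^*`. -/
noncomputable def γ : Matrix (Fin n) (Fin n) ℂ := α - Complex.I • (Psi₂Const d Λ₁ Λ₂ * Λ₂ᴴ)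

/-- `γ̂ = α - i Ψ̂₂ Λ₂^*`. -/
noncomputable def γhat : Matrix (Fin n) (Fin n) ℂ := α - Complex.I • (PsiHat₂ d Λ₁ Λ₂ * Λ₂ᴴ)

/-- `φ(z) = -(i/2) D + Ψ₁(0)^* (γ - z I)⁻¹ Ψ₂`, meaningful for `z ∉ σ(γ)`. -/
noncomputable def φ (z : ℂ) : Matrix (Fin p) (Fin p) ℂ :=
  -(Complex.I / 2) • D d + (Psi₁Zero d Λ₁ Λ₂)ᴴ * (γ d α Λ₁ Λ₂ - z • 1)⁻¹ * Psi₂Const d Λ₁ Λ₂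

/-- `φ̂(z) = (i/2) |D| + Ψ̂₁(0)^* (γ̂ - z I)⁻¹ Ψ̂₂`, meaningful for `z ∉ σ(γ̂)`. -/
noncomputable def φhat (z : ℂ) : Matrix (Fin p) (Fin p) ℂ :=
  (Complex.I / 2) • absD d +
    (PsiHat₁Zero d Λ₁ Λ₂)ᴴ * (γhat d α Λ₁ Λ₂ - z • 1)⁻¹ * PsiHat₂ d Λ₁ Λ₂

end GBDT

end CanonicalSystem

open CanonicalSystem

/-! The proof is a Darboux (GBDT) argument combined with an energy identity. Since `v₀` is
`J`-unitary, `y = v₀ w F` solves `y' = (i z J H₀ - q₀) y`. The Weyl integrand is the Gram matrix of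
`rowβ d * y`, with `rowβ d = [D/2 I]`. As `J q₀` is skew-Hermitian, the energy `y^* J y` has
derivative `-2 Im z` times that Gram matrix. So for `Im z > 0` integrability follows once the
diagonal energies are bounded below (`energy_integrableOn`).

Such `y` are found explicitly. Let `E` be diagonal with `E² = D²`. Then `[I; -E/2]` spans a subspace
invariant under `J H₀`, so the initial system has the solution `g = [I; -E/2] exp(i x z (D - E)/2)
c`. If `K' = -i Λ J H₀ g` and `α K = z K + Λ g`, then `y = g - i J Λ^* Σ⁻¹ K` solves the transformed
system (`darboux_hasEntryDeriv`), and `y^* J y = g^* J g + 2 Im z K^* Σ⁻¹ K` (`darboux_energy`). The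
relation for `K` persists from `x = 0`, where it is a linear equation with matrix `γ - z`; a
suitable `c` gives `y(0) = [I; -iφ(z)]`. The diagonal of `g^* J g` is constant for `E = D` and
nonnegative for `E ≤ 0`, so both choices yield Weyl functions (`isWeylOn_φ`). The choice `E = -|D|`
is `φ̂`; the imaginary part of `γ̂` is then nonpositive, which excludes eigenvalues in the upper
half-plane.

For `D < 0`, subtract two integrable solutions at the same `z`. The energy of the difference starts
at `0`, decreases, and is bounded below by a negative multiple of the integrable Gram entry. It
therefore cannot become negative, hence vanishes identically, and the two Weyl values agree
(`weyl_value_unique`). -/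

namespace CanonicalSystem

/-- Entrywise derivative of a matrix function on `[0, ∞)`, one-sided at `0`. -/
def HasEntryDeriv {l m : Type*} (A : ℝ → Matrix l m ℂ) (A' : Matrix l m ℂ) (x : ℝ) : Prop :=
  ∀ i j, HasDerivWithinAt (fun y => A y i j) (A' i j) (Ici 0) x

/-! ### Entrywise calculus of matrix functions on the half-line -/

section Calculus

variable {k l m : Type*} {A B : ℝ → Matrix l m ℂ} {A' B' : Matrix l m ℂ} {x : ℝ}

theorem HasEntryDeriv.congr_deriv (h : HasEntryDeriv A A' x) (e : A' = B') :
    HasEntryDeriv A B' x := e ▸ h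

theorem hasEntryDeriv_const (C : Matrix l m ℂ) : HasEntryDeriv (fun _ => C) 0 x :=
  fun i j => hasDerivWithinAt_const x _ (C i j)

theorem HasEntryDeriv.add (hA : HasEntryDeriv A A' x) (hB : HasEntryDeriv B B' x) :
    HasEntryDeriv (fun y => A y + B y) (A' + B') x := fun i j => (hA i j).add (hB i j)

theorem HasEntryDeriv.sub (hA : HasEntryDeriv A A' x) (hB : HasEntryDeriv B B' x) :
    HasEntryDeriv (fun y => A y - B y) (A' - B') x := fun i j => (hA i j).sub (hB i j)

theorem HasEntryDeriv.const_smul (c : ℂ) (hA : HasEntryDeriv A A' x) :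
    HasEntryDeriv (fun y => c • A y) (c • A') x := fun i j => (hA i j).const_mul c

theorem HasEntryDeriv.conjTranspose (hA : HasEntryDeriv A A' x) :
    HasEntryDeriv (fun y => (A y)ᴴ) A'ᴴ x := fun i j => (hA j i).star

theorem HasEntryDeriv.mul [Fintype m] {C : ℝ → Matrix m k ℂ} {C' : Matrix m k ℂ}
    (hA : HasEntryDeriv A A' x) (hC : HasEntryDeriv C C' x) :
    HasEntryDeriv (fun y => A y * C y) (A' * C x + A x * C') x := fun i j => by
  simp only [Matrix.add_apply, Matrix.mul_apply, ← Finset.sum_add_distrib]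
  exact HasDerivWithinAt.fun_sum fun t _ => (hA i t).mul (hC t j)

theorem HasEntryDeriv.const_mul [Fintype l] (C : Matrix k l ℂ) (hA : HasEntryDeriv A A' x) :
    HasEntryDeriv (fun y => C * A y) (C * A') x :=
  ((hasEntryDeriv_const C).mul hA).congr_deriv (by simp)

theorem HasEntryDeriv.mul_const [Fintype m] (C : Matrix m k ℂ) (hA : HasEntryDeriv A A' x) :
    HasEntryDeriv (fun y => A y * C) (A' * C) x :=
  (hA.mul (hasEntryDeriv_const C)).congr_deriv (by simp)

theorem HasEntryDeriv.unique (hx : 0 ≤ x) (hA : HasEntryDeriv A A' x)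
    (hB : HasEntryDeriv A B' x) : A' = B' :=
  Matrix.ext fun i j => (uniqueDiffOn_Ici (0 : ℝ) x hx).eq_deriv _ (hA i j) (hB i j)

theorem continuousOn_of_hasEntryDeriv {A' : ℝ → Matrix l m ℂ}
    (h : ∀ x, 0 ≤ x → HasEntryDeriv A (A' x) x) : ContinuousOn A (Ici 0) :=
  continuousOn_pi.2 fun i => continuousOn_pi.2 fun j => fun x hx =>
    (h x hx i j).continuousWithinAt

theorem eq_of_hasEntryDeriv [Fintype l] [Fintype m] {A' : ℝ → Matrix l m ℂ}
    (hA : ∀ x, 0 ≤ x → HasEntryDeriv A (A' x) x)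
    (hB : ∀ x, 0 ≤ x → HasEntryDeriv B (A' x) x) (h0 : A 0 = B 0) (hx : 0 ≤ x) : A x = B x := by
  have h := IsSolution.eqOn (F := fun _ => 0) (u₀ := 0) (u := fun y => A y - B y) (v := fun _ => 0)
    (fun _ => continuousOn_const) ⟨sub_eq_zero.2 h0, fun y hy i j => by
      have := ((hA y hy).sub (hB y hy)) i j
      rwa [sub_self] at this⟩
    ⟨rfl, fun y _ i j => hasDerivWithinAt_const y _ _⟩ (mem_Ici.2 hx)
  exact sub_eq_zero.1 h

/-- Uniqueness for `u' = C(x) u`. -/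
theorem eq_of_linear_ode [Fintype l] [Fintype m] {C : ℝ → Matrix l l ℂ}
    (hC : ContinuousOn C (Ici 0))
    (hA : ∀ x, 0 ≤ x → HasEntryDeriv A (C x * A x) x)
    (hB : ∀ x, 0 ≤ x → HasEntryDeriv B (C x * B x) x) (h0 : A 0 = B 0) (hx : 0 ≤ x) : A x = B x :=
  IsSolution.eqOn (F := fun x => LinearMap.mk (AddHom.mk (fun M => C x * M)
      (fun a b => Matrix.mul_add _ a b)) (fun r M => Matrix.mul_smul _ r M))
    (fun _ => continuousOn_mul hC continuousOn_const)
    ⟨h0, fun y hy => hA y hy⟩ ⟨rfl, fun y hy => hB y hy⟩ (mem_Ici.2 hx)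

theorem exists_primitive {f : ℝ → Matrix l m ℂ} (hf : ContinuousOn f (Ici 0))
    (K₀ : Matrix l m ℂ) :
    ∃ K : ℝ → Matrix l m ℂ, K 0 = K₀ ∧ ∀ x, 0 ≤ x → HasEntryDeriv K (f x) x := by
  -- Replacing `t` by `max t 0` makes the integrand continuous on the whole line, so the two-sided
  -- fundamental theorem of calculus applies at `x = 0` too.
  refine ⟨fun x => K₀ + Matrix.of fun i j => ∫ t in (0 : ℝ)..x, f (max t 0) i j,
    by ext i j; simp, fun x hx i j => ?_⟩
  have hc : Continuous fun t => f (max t 0) i j :=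
    (continuousOn_entry hf i j).comp_continuous (continuous_id.max continuous_const)
      fun t => mem_Ici.2 (le_max_right t 0)
  have h := (intervalIntegral.integral_hasDerivAt_right (hc.intervalIntegrable 0 x)
    (hc.stronglyMeasurableAtFilter _ _) hc.continuousAt).hasDerivWithinAt (s := Ici 0)
  rw [max_eq_left hx] at h
  exact h.const_add (K₀ i j)

theorem differentiableWithinAt_det {𝕜 : Type*} [NontriviallyNormedField 𝕜] [NormedAlgebra 𝕜 ℂ]
    [Fintype m] [DecidableEq m] {A : 𝕜 → Matrix m m ℂ} {s : Set 𝕜} {x : 𝕜}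
    (h : ∀ i j, DifferentiableWithinAt 𝕜 (fun y => A y i j) s x) :
    DifferentiableWithinAt 𝕜 (fun y => (A y).det) s x := by
  simp only [Matrix.det_apply']
  exact DifferentiableWithinAt.fun_sum fun σ _ =>
    (DifferentiableWithinAt.fun_finsetProd fun i _ => h _ _).const_mul _

/-- Cramer's rule reduces the inverse to determinants. The field `𝕜` is general because both the
real variable `x` (for `Σ⁻¹`) and the complex variable `z` (for the resolvent of `γ`) are needed. -/
theorem differentiableWithinAt_inv {𝕜 : Type*} [NontriviallyNormedField 𝕜] [NormedAlgebra 𝕜 ℂ]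
    [Fintype m] [DecidableEq m] {A : 𝕜 → Matrix m m ℂ} {s : Set 𝕜} {x : 𝕜}
    (h : ∀ i j, DifferentiableWithinAt 𝕜 (fun y => A y i j) s x) (hx : (A x).det ≠ 0) (i j : m) :
    DifferentiableWithinAt 𝕜 (fun y => (A y)⁻¹ i j) s x := by
  simp only [Matrix.inv_def, Ring.inverse_eq_inv', Matrix.smul_apply, smul_eq_mul,
    Matrix.adjugate_apply]
  refine ((differentiableWithinAt_det h).fun_inv hx).mul (differentiableWithinAt_det fun a b => ?_)
  by_cases ha : a = j
  · subst ha; simpa using differentiableWithinAt_const _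
  · simpa [Matrix.updateRow_ne ha] using h a b

theorem HasEntryDeriv.inv [Fintype m] [DecidableEq m] {A : ℝ → Matrix m m ℂ} {A' : Matrix m m ℂ}
    (hx : 0 ≤ x) (hdet : ∀ y, 0 ≤ y → IsUnit (A y).det) (hA : HasEntryDeriv A A' x) :
    HasEntryDeriv (fun y => (A y)⁻¹) (-((A x)⁻¹ * A' * (A x)⁻¹)) x := by
  have hd := differentiableWithinAt_inv (fun i j => (hA i j).differentiableWithinAt)
    (hdet x hx).ne_zero
  have h : HasEntryDeriv (fun y => (A y)⁻¹)
      (Matrix.of fun i j => derivWithin (fun y => (A y)⁻¹ i j) (Ici 0) x) x :=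
    fun i j => (hd i j).hasDerivWithinAt
  refine h.congr_deriv ?_
  -- Differentiability being known, the formula comes from differentiating `A A⁻¹ = 1`, which is
  -- needed only on the half-line.
  have h1 : HasEntryDeriv (fun y => A y * (A y)⁻¹) 0 x := fun i j =>
    (hasDerivWithinAt_const x (Ici 0) ((1 : Matrix m m ℂ) i j)).congr
      (fun y hy => congrFun₂ (Matrix.mul_nonsing_inv _ (hdet y hy)) i j)
      (congrFun₂ (Matrix.mul_nonsing_inv _ (hdet x hx)) i j)
  have h2 := congrArg (fun M => (A x)⁻¹ * M) ((hA.mul h).unique hx h1)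
  simp only [Matrix.mul_add, Matrix.mul_zero, ← Matrix.mul_assoc,
    Matrix.nonsing_inv_mul _ (hdet x hx), Matrix.one_mul] at h2
  exact eq_neg_of_add_eq_zero_right h2

end Calculus

end CanonicalSystem

namespace CanonicalSystem

/-! ### Algebraic identities, `J`-unitarity and the Darboux transformation -/

section Algebra

variable {n p : ℕ} (d : Fin p → ℝ) (α : Matrix (Fin n) (Fin n) ℂ)
  (Λ₁ Λ₂ : Matrix (Fin n) (Fin p) ℂ)

/-- The row `[D/2  I]`, so that `H₀ = rowβᴴ * rowβ`. -/
noncomputable def rowβ : Matrix (Fin p) (Fin p ⊕ Fin p) ℂ :=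
  Matrix.fromCols ((1 / 2 : ℂ) • D d) 1

theorem D_conjTranspose : (D d)ᴴ = D d := by
  rw [D, Matrix.diagonal_conjTranspose]
  congr 1
  ext i
  simp

theorem rowβ_conjTranspose : (rowβ d)ᴴ = Matrix.fromRows ((1 / 2 : ℂ) • D d) 1 := by
  rw [rowβ, Matrix.conjTranspose_fromCols_eq_fromRows_conjTranspose, Matrix.conjTranspose_smul,
    D_conjTranspose, Matrix.conjTranspose_one]
  simp

theorem H₀_eq : H₀ d = (rowβ d)ᴴ * rowβ d := by rw [rowβ_conjTranspose]; rfl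

theorem H₀_conjTranspose : (H₀ d)ᴴ = H₀ d := by
  rw [H₀_eq, Matrix.conjTranspose_mul, Matrix.conjTranspose_conjTranspose]

theorem J_conjTranspose : (J p)ᴴ = J p := by
  simp [J, Matrix.fromBlocks_conjTranspose]

theorem J_mul_J : J p * J p = 1 := by
  simp [J, Matrix.fromBlocks_multiply, Matrix.fromBlocks_one]

theorem J_mul_J_mul {k : Type*} (A : Matrix (Fin p ⊕ Fin p) k ℂ) : J p * (J p * A) = A := by
  rw [← Matrix.mul_assoc, J_mul_J, Matrix.one_mul]

theorem J_mul_fromRows {k : Type*} (A B : Matrix (Fin p) k ℂ) :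
    J p * Matrix.fromRows A B = Matrix.fromRows B A := by
  simp [J, ← Matrix.fromRows_fromCols_eq_fromBlocks, Matrix.fromRows_mul,
    Matrix.fromCols_mul_fromRows]

theorem J_mul_rowβ : J p * (rowβ d)ᴴ = Matrix.fromRows 1 ((1 / 2 : ℂ) • D d) := by
  rw [rowβ_conjTranspose, J_mul_fromRows]

theorem Psi₁_eq (x : ℝ) : Psi₁ d α Λ₁ Λ₂ x = Lam d α Λ₁ Λ₂ x * (J p * (rowβ d)ᴴ) := by
  rw [J_mul_rowβ]; rfl

theorem Psi₁_mul_conjTranspose (x : ℝ) : Psi₁ d α Λ₁ Λ₂ x * (Psi₁ d α Λ₁ Λ₂ x)ᴴ =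
    Lam d α Λ₁ Λ₂ x * (J p * (H₀ d * (J p * (Lam d α Λ₁ Λ₂ x)ᴴ))) := by
  simp only [Psi₁_eq, H₀_eq, Matrix.conjTranspose_mul, Matrix.conjTranspose_conjTranspose,
    J_conjTranspose, Matrix.mul_assoc]

variable {x : ℝ}

theorem Lam_zero : Lam d α Λ₁ Λ₂ 0 = Matrix.fromCols Λ₁ Λ₂ := (Lam_spec d α Λ₁ Λ₂).1

theorem Lam_hasEntryDeriv (hx : 0 ≤ x) : HasEntryDeriv (Lam d α Λ₁ Λ₂)
    (-Complex.I • (α * (Lam d α Λ₁ Λ₂ x * (J p * H₀ d)))) x :=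
  HasEntryDeriv.congr_deriv ((Lam_spec d α Λ₁ Λ₂).2 x hx) (by simp only [Matrix.mul_assoc])

theorem Sig_zero : Sig d α Λ₁ Λ₂ 0 = 1 := (Sig_spec d α Λ₁ Λ₂).1

theorem Sig_hasEntryDeriv (hx : 0 ≤ x) : HasEntryDeriv (Sig d α Λ₁ Λ₂)
    (Lam d α Λ₁ Λ₂ x * (J p * (H₀ d * (J p * (Lam d α Λ₁ Λ₂ x)ᴴ)))) x :=
  HasEntryDeriv.congr_deriv ((Sig_spec d α Λ₁ Λ₂).2 x hx) (Psi₁_mul_conjTranspose d α Λ₁ Λ₂ x)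

theorem Sig_conjTranspose (hx : 0 ≤ x) : (Sig d α Λ₁ Λ₂ x)ᴴ = Sig d α Λ₁ Λ₂ x :=
  (Sig_posDef d α Λ₁ Λ₂ hx).1

open scoped ComplexOrder in
theorem Sig_isUnit_det (hx : 0 ≤ x) : IsUnit (Sig d α Λ₁ Λ₂ x).det :=
  isUnit_iff_ne_zero.2 (Sig_posDef d α Λ₁ Λ₂ hx).det_pos.ne'

/-- This is why `Ψ₂` is constant: `Ψ₂'` contains the factor `H₀ [I; -D/2]`. -/
theorem H₀_mul_fromRows_neg :
    H₀ d * (Matrix.fromRows 1 (-(1 / 2 : ℂ) • D d) : Matrix (Fin p ⊕ Fin p) (Fin p) ℂ) = 0 := by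
  rw [H₀_eq, Matrix.mul_assoc, rowβ, Matrix.fromCols_mul_fromRows]
  simp

theorem Psi₂_eq (hx : 0 ≤ x) : Psi₂ d α Λ₁ Λ₂ x = Psi₂Const d Λ₁ Λ₂ := by
  have h := eq_of_hasEntryDeriv (A := Psi₂ d α Λ₁ Λ₂) (B := fun _ => Psi₂ d α Λ₁ Λ₂ 0)
    (A' := fun _ => 0)
    (fun y hy => ((Lam_hasEntryDeriv d α Λ₁ Λ₂ hy).mul_const _).congr_deriv (by
      simp only [Matrix.smul_mul, Matrix.mul_assoc, H₀_mul_fromRows_neg, Matrix.mul_zero,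
        smul_zero]))
    (fun y _ => hasEntryDeriv_const _) rfl hx
  rw [h, Psi₂, Lam_zero]
  refine (Matrix.fromCols_mul_fromRows _ _ _ _).trans ?_
  rw [Psi₂Const, Matrix.mul_smul, Matrix.mul_one,
    neg_smul, sub_eq_add_neg]

theorem Psi₁_zero : Psi₁ d α Λ₁ Λ₂ 0 = Psi₁Zero d Λ₁ Λ₂ := by
  rw [Psi₁, Lam_zero]
  refine (Matrix.fromCols_mul_fromRows _ _ _ _).trans ?_
  rw [Psi₁Zero, Matrix.mul_smul, Matrix.mul_one]

/-- The operator identity `α Σ - Σ α^* = i Λ J Λ^*`. -/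
theorem Sig_identity (hα : α - αᴴ =
      Complex.I • (Matrix.fromCols Λ₁ Λ₂ * J p * (Matrix.fromCols Λ₁ Λ₂)ᴴ)) (hx : 0 ≤ x) :
    α * Sig d α Λ₁ Λ₂ x - Sig d α Λ₁ Λ₂ x * αᴴ =
      Complex.I • (Lam d α Λ₁ Λ₂ x * (J p * (Lam d α Λ₁ Λ₂ x)ᴴ)) := by
  refine eq_of_hasEntryDeriv (fun y hy => ((Sig_hasEntryDeriv d α Λ₁ Λ₂ hy).const_mul α).sub
      ((Sig_hasEntryDeriv d α Λ₁ Λ₂ hy).mul_const αᴴ))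
    (fun y hy => (((Lam_hasEntryDeriv d α Λ₁ Λ₂ hy).mul
      ((Lam_hasEntryDeriv d α Λ₁ Λ₂ hy).conjTranspose.const_mul (J p))).const_smul
        Complex.I).congr_deriv ?_) ?_ hx
  · simp only [Matrix.conjTranspose_smul, Matrix.conjTranspose_mul, J_conjTranspose,
      H₀_conjTranspose, star_neg, Complex.star_def, Complex.conj_I, neg_neg, Matrix.smul_mul,
      Matrix.mul_smul, smul_add, smul_smul, Matrix.mul_assoc, mul_neg, Complex.I_mul_I]
    module
  · simp only [Sig_zero, Lam_zero, Matrix.mul_one, Matrix.one_mul, hα, Matrix.mul_assoc]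

/-- `Σ⁻¹ α - α^* Σ⁻¹ = i Σ⁻¹ Λ J Λ^* Σ⁻¹`. -/
theorem Sig_inv_identity (hα : α - αᴴ =
      Complex.I • (Matrix.fromCols Λ₁ Λ₂ * J p * (Matrix.fromCols Λ₁ Λ₂)ᴴ)) (hx : 0 ≤ x) :
    αᴴ * (Sig d α Λ₁ Λ₂ x)⁻¹ = (Sig d α Λ₁ Λ₂ x)⁻¹ * α -
      Complex.I • ((Sig d α Λ₁ Λ₂ x)⁻¹ * (Lam d α Λ₁ Λ₂ x * (J p *
        ((Lam d α Λ₁ Λ₂ x)ᴴ * (Sig d α Λ₁ Λ₂ x)⁻¹)))) := by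
  have h := congrArg (fun M => (Sig d α Λ₁ Λ₂ x)⁻¹ * (M * (Sig d α Λ₁ Λ₂ x)⁻¹))
    (Sig_identity d α Λ₁ Λ₂ hα hx)
  have hu := Sig_isUnit_det d α Λ₁ Λ₂ hx
  simp only [Matrix.mul_sub, Matrix.sub_mul, Matrix.mul_assoc, Matrix.mul_nonsing_inv _ hu,
    Matrix.mul_one, Matrix.nonsing_inv_mul_cancel_left _ _ hu, Matrix.smul_mul,
    Matrix.mul_smul] at h
  rw [← h]
  abel

/-- `J q₀` has the form `A - A^*` because `J² = 1` and `Σ`, `H₀`, `J` are Hermitian. This skewness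
makes `v₀` `J`-unitary and removes `q₀` from the energy balance. -/
theorem J_mul_q₀ (hx : 0 ≤ x) : J p * q₀ d α Λ₁ Λ₂ x = -((q₀ d α Λ₁ Λ₂ x)ᴴ * J p) := by
  simp only [q₀, Matrix.conjTranspose_sub, Matrix.conjTranspose_mul, J_conjTranspose,
    H₀_conjTranspose, Matrix.conjTranspose_nonsing_inv, Sig_conjTranspose d α Λ₁ Λ₂ hx,
    Matrix.conjTranspose_conjTranspose, Matrix.mul_sub, Matrix.sub_mul, Matrix.mul_assoc,
    J_mul_J_mul, J_mul_J, Matrix.mul_one]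
  abel

theorem v₀_zero : v₀ d α Λ₁ Λ₂ 0 = 1 := (v₀_spec d α Λ₁ Λ₂).1

theorem v₀_hasEntryDeriv (hx : 0 ≤ x) : HasEntryDeriv (v₀ d α Λ₁ Λ₂)
    (-q₀ d α Λ₁ Λ₂ x * v₀ d α Λ₁ Λ₂ x) x := (v₀_spec d α Λ₁ Λ₂).2 x hx

theorem v₀_conjTranspose_J_v₀ (hx : 0 ≤ x) :
    (v₀ d α Λ₁ Λ₂ x)ᴴ * (J p * v₀ d α Λ₁ Λ₂ x) = J p := by
  refine eq_of_hasEntryDeriv (A' := fun _ => 0) (B := fun _ => J p)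
    (fun y hy => ((v₀_hasEntryDeriv d α Λ₁ Λ₂ hy).conjTranspose.mul
      ((v₀_hasEntryDeriv d α Λ₁ Λ₂ hy).const_mul (J p))).congr_deriv ?_)
    (fun y _ => hasEntryDeriv_const _) (by simp [v₀_zero]) hx
  have h := J_mul_q₀ d α Λ₁ Λ₂ hy
  simp only [Matrix.conjTranspose_mul, Matrix.conjTranspose_neg, Matrix.mul_neg, Matrix.neg_mul]
  rw [← Matrix.mul_assoc (J p), h]
  simp only [Matrix.mul_assoc, Matrix.neg_mul, Matrix.mul_neg]
  abel

theorem v₀_J_v₀_conjTranspose (hx : 0 ≤ x) :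
    v₀ d α Λ₁ Λ₂ x * (J p * (v₀ d α Λ₁ Λ₂ x)ᴴ) = J p := by
  have h : (J p * (v₀ d α Λ₁ Λ₂ x)ᴴ * J p) * v₀ d α Λ₁ Λ₂ x = 1 := by
    simp only [Matrix.mul_assoc, v₀_conjTranspose_J_v₀ d α Λ₁ Λ₂ hx, J_mul_J]
  have h1 := congrArg (· * J p) (mul_eq_one_comm.1 h)
  simpa only [Matrix.mul_assoc, J_mul_J, Matrix.mul_one, Matrix.one_mul] using h1

/-- `v₀(x) w(x, z)` solves `u' = (i z J H₀ - q₀) u`. -/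
theorem v₀_fundamentalSolution_hasEntryDeriv {k : Type*} (z : ℂ)
    (F : Matrix (Fin p ⊕ Fin p) k ℂ) (hx : 0 ≤ x) :
    HasEntryDeriv (fun y => v₀ d α Λ₁ Λ₂ y * (fundamentalSolution (Ham d α Λ₁ Λ₂) z y * F))
      (((Complex.I * z) • (J p * H₀ d) - q₀ d α Λ₁ Λ₂ x) *
        (v₀ d α Λ₁ Λ₂ x * (fundamentalSolution (Ham d α Λ₁ Λ₂) z x * F))) x := by
  have hw : HasEntryDeriv (fundamentalSolution (Ham d α Λ₁ Λ₂) z)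
      ((Complex.I * z) • (J p * Ham d α Λ₁ Λ₂ x) * fundamentalSolution (Ham d α Λ₁ Λ₂) z x) x :=
    (fundamentalSolution_spec (Ham_continuousOn d α Λ₁ Λ₂) z).2 x hx
  refine ((v₀_hasEntryDeriv d α Λ₁ Λ₂ hx).mul (hw.mul_const F)).congr_deriv ?_
  -- `J`-unitarity of `v₀` intertwines `J H` with the constant matrix `J H₀`.
  have h : v₀ d α Λ₁ Λ₂ x * (J p * Ham d α Λ₁ Λ₂ x) = J p * (H₀ d * v₀ d α Λ₁ Λ₂ x) := by
    conv_rhs => rw [← v₀_J_v₀_conjTranspose d α Λ₁ Λ₂ hx]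
    simp only [Ham, Matrix.mul_assoc]
  simp only [Matrix.smul_mul, Matrix.mul_smul, Matrix.sub_mul, Matrix.neg_mul, Matrix.mul_assoc]
  rw [← Matrix.mul_assoc (J p), ← Matrix.mul_assoc (v₀ d α Λ₁ Λ₂ x) (J p * _), h]
  simp only [Matrix.mul_assoc]
  abel

/-- Darboux transformation: a solution `g` of the initial system, together with a primitive `K` of
`-i Λ J H₀ g`, yields a solution of the transformed system. -/
theorem darboux_hasEntryDeriv {k : Type*} (hα : α - αᴴ =
      Complex.I • (Matrix.fromCols Λ₁ Λ₂ * J p * (Matrix.fromCols Λ₁ Λ₂)ᴴ)) {z : ℂ}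
    {g : ℝ → Matrix (Fin p ⊕ Fin p) k ℂ} {K : ℝ → Matrix (Fin n) k ℂ}
    (hg : HasEntryDeriv g ((Complex.I * z) • (J p * (H₀ d * g x))) x)
    (hK : HasEntryDeriv K (-Complex.I • (Lam d α Λ₁ Λ₂ x * (J p * (H₀ d * g x)))) x)
    (hKx : α * K x = z • K x + Lam d α Λ₁ Λ₂ x * g x) (hx : 0 ≤ x) :
    HasEntryDeriv (fun y => g y - Complex.I •
        (J p * ((Lam d α Λ₁ Λ₂ y)ᴴ * ((Sig d α Λ₁ Λ₂ y)⁻¹ * K y))))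
      (((Complex.I * z) • (J p * H₀ d) - q₀ d α Λ₁ Λ₂ x) * (g x - Complex.I •
        (J p * ((Lam d α Λ₁ Λ₂ x)ᴴ * ((Sig d α Λ₁ Λ₂ x)⁻¹ * K x))))) x := by
  have hS := (Sig_hasEntryDeriv d α Λ₁ Λ₂ hx).inv hx (fun y hy => Sig_isUnit_det d α Λ₁ Λ₂ hy)
  refine (hg.sub (((((Lam_hasEntryDeriv d α Λ₁ Λ₂ hx).conjTranspose.mul
    (hS.mul hK)).const_mul (J p))).const_smul Complex.I)).congr_deriv ?_
  have h1 := Sig_inv_identity d α Λ₁ Λ₂ hα hx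
  simp only [Matrix.conjTranspose_smul, Matrix.conjTranspose_mul, J_conjTranspose,
      H₀_conjTranspose, star_neg, Complex.star_def, Complex.conj_I, neg_neg, q₀,
      Matrix.smul_mul, Matrix.mul_assoc]
  rw [← Matrix.mul_assoc αᴴ, h1]
  simp only [Matrix.mul_assoc, Matrix.sub_mul, Matrix.smul_mul, hKx, Matrix.mul_add,
    Matrix.mul_sub, Matrix.mul_smul, Matrix.mul_neg, Matrix.neg_mul]
  simp only [smul_add, smul_sub, smul_neg, smul_smul, neg_smul, Complex.I_mul_I, mul_one]
  simp only [← mul_assoc, Complex.I_mul_I]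
  module

/-- The cross terms are rewritten by `Λ G = α K - z K`, and the quadratic term `K^* Σ⁻¹ Λ J Λ^* Σ⁻¹
K` by the identity for `Σ⁻¹`. All terms with `α` cancel, leaving `-i(z - z̄) = 2 Im z` times `K^*
Σ⁻¹ K`. -/
theorem darboux_energy {k : Type*} (hα : α - αᴴ =
      Complex.I • (Matrix.fromCols Λ₁ Λ₂ * J p * (Matrix.fromCols Λ₁ Λ₂)ᴴ)) {z : ℂ}
    {G : Matrix (Fin p ⊕ Fin p) k ℂ} {K : Matrix (Fin n) k ℂ}
    (hK : α * K = z • K + Lam d α Λ₁ Λ₂ x * G) (hx : 0 ≤ x) :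
    (G - Complex.I • (J p * ((Lam d α Λ₁ Λ₂ x)ᴴ * ((Sig d α Λ₁ Λ₂ x)⁻¹ * K))))ᴴ * (J p *
        (G - Complex.I • (J p * ((Lam d α Λ₁ Λ₂ x)ᴴ * ((Sig d α Λ₁ Λ₂ x)⁻¹ * K))))) =
      Gᴴ * (J p * G) + ((2 * z.im : ℝ) : ℂ) • (Kᴴ * ((Sig d α Λ₁ Λ₂ x)⁻¹ * K)) := by
  have h1 := Sig_inv_identity d α Λ₁ Λ₂ hα hx
  have hG : Lam d α Λ₁ Λ₂ x * G = α * K - z • K := by rw [hK]; abel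
  have hG' : Gᴴ * (Lam d α Λ₁ Λ₂ x)ᴴ = Kᴴ * αᴴ - (starRingEnd ℂ z) • Kᴴ := by
    rw [← Matrix.conjTranspose_mul, hG, Matrix.conjTranspose_sub, Matrix.conjTranspose_smul,
      Matrix.conjTranspose_mul, Complex.star_def]
  have hz : ((2 * z.im : ℝ) : ℂ) = -Complex.I * (z - starRingEnd ℂ z) := by
    rw [Complex.sub_conj]
    push_cast
    linear_combination (2 * z.im : ℂ) * Complex.I_mul_I
  simp only [Matrix.conjTranspose_sub, Matrix.conjTranspose_smul, Matrix.conjTranspose_mul,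
    Matrix.conjTranspose_conjTranspose, Matrix.conjTranspose_nonsing_inv,
    Sig_conjTranspose d α Λ₁ Λ₂ hx, J_conjTranspose, Complex.star_def, Complex.conj_I,
    Matrix.mul_sub, Matrix.sub_mul, Matrix.smul_mul, Matrix.mul_smul, Matrix.mul_assoc,
    J_mul_J_mul, hG]
  rw [← Matrix.mul_assoc Gᴴ (Lam d α Λ₁ Λ₂ x)ᴴ, hG', Matrix.sub_mul, Matrix.mul_assoc,
    ← Matrix.mul_assoc αᴴ, h1, hz]
  simp only [Matrix.mul_sub, Matrix.sub_mul, Matrix.smul_mul, Matrix.mul_smul, Matrix.mul_assoc,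
    smul_sub, smul_smul, neg_mul, Complex.I_mul_I, neg_smul, smul_neg, one_smul]
  module

/-- The diagonal `e` is free so that the identity covers both `γ` (`e = d`) and `γ̂` (`e = -|d|`).
-/
theorem γ_sub_conjTranspose (e : Fin p → ℝ) (hα : α - αᴴ =
      Complex.I • (Matrix.fromCols Λ₁ Λ₂ * J p * (Matrix.fromCols Λ₁ Λ₂)ᴴ)) :
    γ e α Λ₁ Λ₂ - (γ e α Λ₁ Λ₂)ᴴ = Complex.I • (Λ₂ * D e * Λ₂ᴴ) := by
  have h : α = αᴴ + Complex.I • (Λ₂ * Λ₁ᴴ + Λ₁ * Λ₂ᴴ) := by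
    rw [← sub_eq_iff_eq_add', hα, Matrix.conjTranspose_fromCols_eq_fromRows_conjTranspose,
      Matrix.mul_assoc, J_mul_fromRows, Matrix.fromCols_mul_fromRows, add_comm]
  rw [γ, Matrix.conjTranspose_sub]
  -- Only the bare `α` is replaced; rewriting inside `αᴴ` as well would undo the cancellation.
  nth_rewrite 1 [h]
  simp only [Psi₂Const, Matrix.conjTranspose_sub, Matrix.conjTranspose_smul,
    Matrix.conjTranspose_mul, D_conjTranspose, Matrix.conjTranspose_conjTranspose,
    Complex.star_def, Complex.conj_I, Matrix.sub_mul,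
    Matrix.smul_mul, Matrix.mul_assoc, map_div₀, map_one, map_ofNat]
  module

end Algebra

end CanonicalSystem

namespace CanonicalSystem

/-! ### Gram matrices: diagonal entries control all entries -/

section Gram

variable {l m : Type*} [Fintype l]

theorem gram_apply_self (B : Matrix l m ℂ) (j : m) :
    (Bᴴ * B) j j = ((∑ k, ‖B k j‖ ^ 2 : ℝ) : ℂ) := by
  rw [Matrix.mul_apply, Complex.ofReal_sum]
  refine Finset.sum_congr rfl fun k _ => ?_
  rw [Matrix.conjTranspose_apply, Complex.star_def, mul_comm, Complex.mul_conj,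
    Complex.normSq_eq_norm_sq]

theorem gram_apply_self_re (B : Matrix l m ℂ) (j : m) :
    ((Bᴴ * B) j j).re = ∑ k, ‖B k j‖ ^ 2 := by
  rw [gram_apply_self, Complex.ofReal_re]

theorem gram_apply_self_re_nonneg (B : Matrix l m ℂ) (j : m) : 0 ≤ ((Bᴴ * B) j j).re := by
  rw [gram_apply_self_re]
  positivity

/-- By `ab ≤ a² + b²` termwise. It reduces integrability of a Gram matrix to that of its diagonal.
-/
theorem norm_gram_apply_le (B : Matrix l m ℂ) (i j : m) :
    ‖(Bᴴ * B) i j‖ ≤ ((Bᴴ * B) i i).re + ((Bᴴ * B) j j).re := by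
  rw [gram_apply_self_re, gram_apply_self_re, Matrix.mul_apply, ← Finset.sum_add_distrib]
  refine norm_sum_le_of_le _ fun k _ => ?_
  rw [Matrix.conjTranspose_apply, norm_mul, norm_star]
  nlinarith [sq_nonneg (‖B k i‖ - ‖B k j‖), sq_nonneg ‖B k i‖, sq_nonneg ‖B k j‖]

theorem gram_sub_apply_self_re_le (A B : Matrix l m ℂ) (j : m) :
    (((A - B)ᴴ * (A - B)) j j).re ≤ 2 * ((Aᴴ * A) j j).re + 2 * ((Bᴴ * B) j j).re := by
  simp only [gram_apply_self_re, Finset.mul_sum, ← Finset.sum_add_distrib]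
  refine Finset.sum_le_sum fun k _ => ?_
  have h := norm_sub_le (A k j) (B k j)
  rw [Matrix.sub_apply]
  nlinarith [sq_nonneg (‖A k j‖ - ‖B k j‖), norm_nonneg (A k j - B k j), norm_nonneg (A k j),
    norm_nonneg (B k j)]

theorem gram_continuousOn {B : ℝ → Matrix l m ℂ} {s : Set ℝ} (hB : ContinuousOn B s) (i j : m) :
    ContinuousOn (fun x => ((B x)ᴴ * B x) i j) s :=
  continuousOn_entry (continuousOn_mul (continuousOn_conjTranspose hB) hB) i j

theorem gram_integrableOn {B : ℝ → Matrix l m ℂ} (hB : ContinuousOn B (Ici 0))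
    (h : ∀ j, IntegrableOn (fun x => (((B x)ᴴ * B x) j j).re) (Ici 0)) (i j : m) :
    IntegrableOn (fun x => ((B x)ᴴ * B x) i j) (Ici 0) :=
  Integrable.mono' ((h i).add (h j))
    ((gram_continuousOn hB i j).aestronglyMeasurable measurableSet_Ici)
    (Filter.Eventually.of_forall fun x => norm_gram_apply_le (B x) i j)

end Gram

/-! ### Scalar lemmas linking energy and integrability -/

/-- A function with derivative `-c f`, `c > 0`, `f ≥ 0`, that is bounded below, forces `f` to be
integrable. -/
theorem integrableOn_of_bounded_below {E f : ℝ → ℝ} {c C : ℝ} (hc : 0 < c)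
    (hf : ContinuousOn f (Ici 0)) (hf0 : ∀ x, 0 ≤ x → 0 ≤ f x)
    (hE : ∀ x, 0 ≤ x → HasDerivWithinAt E (-c * f x) (Ici 0) x) (hC : ∀ x, 0 ≤ x → C ≤ E x) :
    IntegrableOn f (Ici 0) := by
  rw [integrableOn_Ici_iff_integrableOn_Ioi]
  have hi : ∀ b : ℝ, 0 ≤ b → IntervalIntegrable f volume 0 b := fun b hb => by
    apply ContinuousOn.intervalIntegrable
    rw [uIcc_of_le hb]
    exact hf.mono Icc_subset_Ici_self
  refine integrableOn_Ioi_of_intervalIntegral_norm_bounded ((E 0 - C) / c) 0 (fun b : ℝ => ?_)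
    Filter.tendsto_id ((Filter.eventually_ge_atTop 0).mono fun b hb => ?_)
  · exact ((hf.mono Icc_subset_Ici_self).integrableOn_Icc (b := b)).mono_set Ioc_subset_Icc_self
  · have h1 : ∫ t in (0 : ℝ)..b, ‖f t‖ = ∫ t in (0 : ℝ)..b, f t :=
      intervalIntegral.integral_congr fun t ht => by
        rw [uIcc_of_le hb] at ht
        exact Real.norm_of_nonneg (hf0 t ht.1)
    have h2 : ∫ t in (0 : ℝ)..b, -c * f t = E b - E 0 :=
      intervalIntegral.integral_eq_sub_of_hasDeriv_right
        (fun t ht => ((hE t (by rw [uIcc_of_le hb] at ht; exact ht.1)).continuousWithinAt).mono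
          (by rw [uIcc_of_le hb]; exact Icc_subset_Ici_self))
        (fun t ht => (hE t (by rw [min_eq_left hb] at ht; exact ht.1.le)).mono
          (by rw [min_eq_left hb] at ht; exact Ioi_subset_Ici ht.1.le))
        ((hi b hb).const_mul _)
    rw [intervalIntegral.integral_const_mul] at h2
    rw [id, h1, le_div_iff₀ hc]
    have := hC b hb
    linarith

/-- A function `E` with `E(0) = 0`, `E' = -c f`, and `E ≥ -C f` with `f ≥ 0` integrable has
`f(0) = 0`. -/
theorem eq_zero_of_integrableOn {E f : ℝ → ℝ} {c C : ℝ} (hc : 0 < c)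
    (hf0 : ∀ x, 0 ≤ x → 0 ≤ f x) (hf : IntegrableOn f (Ici 0)) (hE0 : E 0 = 0)
    (hE : ∀ x, 0 ≤ x → HasDerivWithinAt E (-c * f x) (Ici 0) x)
    (hC : ∀ x, 0 ≤ x → -(C * f x) ≤ E x) : f 0 = 0 := by
  have hanti : AntitoneOn E (Ici 0) := antitoneOn_of_hasDerivWithinAt_nonpos
    (f' := fun x => -c * f x) (convex_Ici 0)
    (fun x hx => (hE x hx).continuousWithinAt)
    (fun x hx => (hE x (interior_subset hx)).mono interior_subset)
    (fun x hx => by nlinarith [hf0 x (interior_subset hx)])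
  by_cases h : ∀ x, 0 ≤ x → 0 ≤ E x
  · have hz : ∀ x ∈ Ici (0 : ℝ), E x = 0 := fun x hx => le_antisymm
      (hE0 ▸ hanti self_mem_Ici hx hx) (h x hx)
    have h1 := (uniqueDiffOn_Ici (0 : ℝ) 0 self_mem_Ici).eq_deriv _ (hE 0 le_rfl)
      ((hasDerivWithinAt_const (0 : ℝ) (Ici 0) (0 : ℝ)).congr hz hE0)
    simpa [hc.ne'] using h1
  · push Not at h
    obtain ⟨x₀, hx₀, hneg⟩ := h
    exfalso
    have hCf : IntegrableOn (fun x => C * f x) (Ici x₀) :=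
      (hf.mono_set (Ici_subset_Ici.2 hx₀)).const_mul C
    -- Since `E` is nonincreasing, `C f ≥ -E ≥ -E x₀ > 0` beyond `x₀`, so a positive constant would
    -- be integrable on a half-line.
    have hconst : IntegrableOn (fun _ : ℝ => -E x₀) (Ici x₀) := by
      refine Integrable.mono' hCf aestronglyMeasurable_const
        ((ae_restrict_iff' measurableSet_Ici).2 (Filter.Eventually.of_forall fun x hx => ?_))
      have hx0 : 0 ≤ x := hx₀.trans hx
      rw [Real.norm_of_nonneg (by linarith)]
      linarith [hC x hx0, hanti hx₀ hx0 hx]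
    rw [integrableOn_const_iff] at hconst
    rcases hconst with h | h
    · exact hneg.ne (by simpa using h)
    · simp at h

/-! ### The energy `y^* J y` and uniqueness of Weyl values for `D < 0` -/

section Energy

variable {n p : ℕ} (d : Fin p → ℝ) (α : Matrix (Fin n) (Fin n) ℂ)
  (Λ₁ Λ₂ : Matrix (Fin n) (Fin p) ℂ) {x : ℝ}

/-- The `q₀` terms cancel because `J q₀` is skew-Hermitian; the rest is `i(z - z̄) y^* H₀ y`. -/
theorem energy_hasEntryDeriv {k : Type*} {z : ℂ} {y : ℝ → Matrix (Fin p ⊕ Fin p) k ℂ}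
    (hy : HasEntryDeriv y (((Complex.I * z) • (J p * H₀ d) - q₀ d α Λ₁ Λ₂ x) * y x) x)
    (hx : 0 ≤ x) :
    HasEntryDeriv (fun t => (y t)ᴴ * (J p * y t))
      (((-(2 * z.im) : ℝ) : ℂ) • ((rowβ d * y x)ᴴ * (rowβ d * y x))) x := by
  refine (hy.conjTranspose.mul (hy.const_mul (J p))).congr_deriv ?_
  have hz : ((-(2 * z.im) : ℝ) : ℂ) = Complex.I * (z - starRingEnd ℂ z) := by
    rw [Complex.sub_conj]
    push_cast
    linear_combination (-2 * z.im : ℂ) * Complex.I_mul_I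
  have hH : (rowβ d * y x)ᴴ * (rowβ d * y x) = (y x)ᴴ * (H₀ d * y x) := by
    rw [H₀_eq, Matrix.conjTranspose_mul]
    simp only [Matrix.mul_assoc]
  rw [hz, hH]
  simp only [Matrix.sub_mul, Matrix.mul_sub, Matrix.conjTranspose_sub, Matrix.conjTranspose_mul,
    Matrix.conjTranspose_smul, J_conjTranspose, H₀_conjTranspose, Matrix.smul_mul,
    Matrix.mul_smul, Matrix.mul_assoc, J_mul_J_mul, Complex.star_def, map_mul, Complex.conj_I]
  rw [← Matrix.mul_assoc (J p) (q₀ d α Λ₁ Λ₂ x), J_mul_q₀ d α Λ₁ Λ₂ hx]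
  simp only [Matrix.neg_mul, Matrix.mul_neg, Matrix.mul_assoc]
  module

theorem energy_re_hasDerivWithinAt {k : Type*} {z : ℂ} {y : ℝ → Matrix (Fin p ⊕ Fin p) k ℂ}
    (hy : HasEntryDeriv y (((Complex.I * z) • (J p * H₀ d) - q₀ d α Λ₁ Λ₂ x) * y x) x)
    (hx : 0 ≤ x) (j : k) :
    HasDerivWithinAt (fun t => (((y t)ᴴ * (J p * y t)) j j).re)
      (-(2 * z.im) * (((rowβ d * y x)ᴴ * (rowβ d * y x)) j j).re) (Ici 0) x := by
  have h := Complex.reCLM.hasFDerivAt.comp_hasDerivWithinAt x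
    (energy_hasEntryDeriv d α Λ₁ Λ₂ hy hx j j)
  rwa [Matrix.smul_apply, smul_eq_mul, Complex.reCLM_apply, Complex.re_ofReal_mul] at h

theorem energy_integrableOn {k : Type*} {z : ℂ} {y : ℝ → Matrix (Fin p ⊕ Fin p) k ℂ}
    (hz : 0 < z.im) (hy : ∀ x, 0 ≤ x →
      HasEntryDeriv y (((Complex.I * z) • (J p * H₀ d) - q₀ d α Λ₁ Λ₂ x) * y x) x)
    (C : k → ℝ) (hC : ∀ j x, 0 ≤ x → C j ≤ (((y x)ᴴ * (J p * y x)) j j).re) (i j : k) :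
    IntegrableOn (fun x => ((rowβ d * y x)ᴴ * (rowβ d * y x)) i j) (Ici 0) := by
  have hc : ContinuousOn (fun x => rowβ d * y x) (Ici 0) :=
    continuousOn_mul continuousOn_const (continuousOn_of_hasEntryDeriv hy)
  refine gram_integrableOn hc (fun j => ?_) i j
  exact integrableOn_of_bounded_below (c := 2 * z.im) (by positivity)
    (Complex.continuous_re.comp_continuousOn (gram_continuousOn hc j j))
    (fun x _ => gram_apply_self_re_nonneg _ j)
    (fun x hx => energy_re_hasDerivWithinAt d α Λ₁ Λ₂ (hy x hx) hx j) (hC j)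

theorem J_form_re (y : Matrix (Fin p ⊕ Fin p) (Fin p) ℂ) (j : Fin p) :
    ((yᴴ * (J p * y)) j j).re =
      ∑ k, 2 * ((y (Sum.inl k) j).re * (y (Sum.inr k) j).re +
        (y (Sum.inl k) j).im * (y (Sum.inr k) j).im) := by
  have h1 : ∀ k, (J p * y) (Sum.inl k) j = y (Sum.inr k) j := fun k => by
    simp [J, Matrix.mul_apply, Matrix.one_apply]
  have h2 : ∀ k, (J p * y) (Sum.inr k) j = y (Sum.inl k) j := fun k => by
    simp [J, Matrix.mul_apply, Matrix.one_apply]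
  rw [Matrix.mul_apply, Fintype.sum_sum_type]
  simp only [Matrix.conjTranspose_apply, h1, h2, ← Finset.sum_add_distrib, Complex.re_sum]
  refine Finset.sum_congr rfl fun k _ => ?_
  simp
  ring

theorem rowβ_mul_apply (y : Matrix (Fin p ⊕ Fin p) (Fin p) ℂ) (k j : Fin p) :
    (rowβ d * y) k j = ((d k / 2 : ℝ) : ℂ) * y (Sum.inl k) j + y (Sum.inr k) j := by
  rw [Matrix.mul_apply, Fintype.sum_sum_type]
  simp [rowβ, D, Matrix.one_apply, Matrix.diagonal_apply, div_eq_inv_mul]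

/-- For each row with upper and lower entries `a`, `b`, polarization gives `2 d Re(a b̄) = |b +
da/2|² - |b - da/2|²`. Dividing by `d < 0` and discarding the second square bounds the row from
below; the constant sums the factors `1/|d_k|`. -/
theorem neg_le_J_form (hd : ∀ i, d i < 0) (y : Matrix (Fin p ⊕ Fin p) (Fin p) ℂ) (j : Fin p) :
    -((∑ k, (-d k)⁻¹) * (((rowβ d * y)ᴴ * (rowβ d * y)) j j).re) ≤ ((yᴴ * (J p * y)) j j).re := by
  rw [gram_apply_self_re, J_form_re, Finset.sum_mul, ← Finset.sum_neg_distrib]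
  refine Finset.sum_le_sum fun k _ => ?_
  have hk : 0 < -d k := neg_pos.2 (hd k)
  have h1 : ‖(rowβ d * y) k j‖ ^ 2 ≤ ∑ i, ‖(rowβ d * y) i j‖ ^ 2 :=
    Finset.single_le_sum (f := fun i => ‖(rowβ d * y) i j‖ ^ 2) (fun i _ => by positivity)
      (Finset.mem_univ k)
  have h2 : (-d k)⁻¹ * ‖(rowβ d * y) k j‖ ^ 2 ≤ (-d k)⁻¹ * ∑ i, ‖(rowβ d * y) i j‖ ^ 2 :=
    mul_le_mul_of_nonneg_left h1 (inv_pos.2 hk).le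
  refine (neg_le_neg h2).trans ?_
  rw [neg_le, le_inv_mul_iff₀ hk, rowβ_mul_apply, ← Complex.normSq_eq_norm_sq,
    Complex.normSq_apply]
  simp only [Complex.add_re, Complex.add_im, Complex.re_ofReal_mul, Complex.im_ofReal_mul]
  nlinarith [sq_nonneg ((y (Sum.inr k) j).re - d k / 2 * (y (Sum.inl k) j).re),
    sq_nonneg ((y (Sum.inr k) j).im - d k / 2 * (y (Sum.inl k) j).im)]

theorem weylIntegrand_eq (ψ : ℂ → Matrix (Fin p) (Fin p) ℂ) (z : ℂ) (x : ℝ) :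
    weylIntegrand (Ham d α Λ₁ Λ₂) ψ z x =
      (rowβ d * (v₀ d α Λ₁ Λ₂ x * (fundamentalSolution (Ham d α Λ₁ Λ₂) z x *
        (Matrix.fromRows 1 (-Complex.I • ψ z) : Matrix (Fin p ⊕ Fin p) (Fin p) ℂ))))ᴴ *
      (rowβ d * (v₀ d α Λ₁ Λ₂ x * (fundamentalSolution (Ham d α Λ₁ Λ₂) z x *
        (Matrix.fromRows 1 (-Complex.I • ψ z) : Matrix (Fin p ⊕ Fin p) (Fin p) ℂ)))) := by
  have h : (Matrix.fromCols 1 (Complex.I • (ψ z)ᴴ) : Matrix (Fin p) (Fin p ⊕ Fin p) ℂ) =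
      (Matrix.fromRows 1 (-Complex.I • ψ z) : Matrix (Fin p ⊕ Fin p) (Fin p) ℂ)ᴴ := by
    simp [Matrix.conjTranspose_fromRows_eq_fromCols_conjTranspose]
  rw [weylIntegrand, h, Ham, H₀_eq]
  simp only [Matrix.conjTranspose_mul, Matrix.mul_assoc]

/-- For `D < 0` the integrability condition at a point determines the value there. -/
theorem weyl_value_unique (hd : ∀ i, d i < 0) {z : ℂ} (hz : 0 < z.im)
    {ψ χ : ℂ → Matrix (Fin p) (Fin p) ℂ}
    (hψ : ∀ i j, IntegrableOn (fun x => weylIntegrand (Ham d α Λ₁ Λ₂) ψ z x i j) (Ici 0))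
    (hχ : ∀ i j, IntegrableOn (fun x => weylIntegrand (Ham d α Λ₁ Λ₂) χ z x i j) (Ici 0)) :
    ψ z = χ z := by
  let F : (ℂ → Matrix (Fin p) (Fin p) ℂ) → Matrix (Fin p ⊕ Fin p) (Fin p) ℂ :=
    fun ψ => Matrix.fromRows 1 (-Complex.I • ψ z)
  let u : Matrix (Fin p ⊕ Fin p) (Fin p) ℂ → ℝ → Matrix (Fin p ⊕ Fin p) (Fin p) ℂ := fun G x =>
    v₀ d α Λ₁ Λ₂ x * (fundamentalSolution (Ham d α Λ₁ Λ₂) z x * G)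
  have hu : ∀ G x, 0 ≤ x → HasEntryDeriv (u G)
      (((Complex.I * z) • (J p * H₀ d) - q₀ d α Λ₁ Λ₂ x) * u G x) x := fun G x hx =>
    v₀_fundamentalSolution_hasEntryDeriv d α Λ₁ Λ₂ z G hx
  have hsub : ∀ x, rowβ d * u (F ψ - F χ) x = rowβ d * u (F ψ) x - rowβ d * u (F χ) x := fun x => by
    simp only [u, Matrix.mul_sub]
  have hu0 : u (F ψ - F χ) 0 = F ψ - F χ := by
    simp only [u, v₀_zero, (fundamentalSolution_spec (Ham_continuousOn d α Λ₁ Λ₂) z).1,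
      Matrix.one_mul]
  have hc : ContinuousOn (fun x => rowβ d * u (F ψ - F χ) x) (Ici 0) :=
    continuousOn_mul continuousOn_const (continuousOn_of_hasEntryDeriv (hu _))
  -- Both initial columns have upper block `I`, so the difference has upper block `0` and its energy
  -- vanishes at `x = 0`.
  have htop : ∀ k j, (F ψ - F χ) (Sum.inl k) j = 0 := fun k j => by simp [F]
  have key : ∀ j, (((rowβ d * u (F ψ - F χ) 0)ᴴ * (rowβ d * u (F ψ - F χ) 0)) j j).re = 0 := by
    intro j
    refine eq_zero_of_integrableOn (E := fun x => (((u (F ψ - F χ) x)ᴴ *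
        (J p * u (F ψ - F χ) x)) j j).re)
      (f := fun x => (((rowβ d * u (F ψ - F χ) x)ᴴ * (rowβ d * u (F ψ - F χ) x)) j j).re)
      (c := 2 * z.im) (C := ∑ k, (-d k)⁻¹) (by positivity)
      (fun x _ => gram_apply_self_re_nonneg _ j) ?_ ?_
      (fun x hx => energy_re_hasDerivWithinAt d α Λ₁ Λ₂ (hu _ x hx) hx j)
      (fun x _ => neg_le_J_form d hd _ j)
    · have hψ' := (hψ j j).re.const_mul 2
      have hχ' := (hχ j j).re.const_mul 2
      simp only [weylIntegrand_eq] at hψ' hχ'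
      refine Integrable.mono' (hψ'.add hχ') ((Complex.continuous_re.comp_continuousOn
        (gram_continuousOn hc j j)).aestronglyMeasurable measurableSet_Ici)
        (Filter.Eventually.of_forall fun x => ?_)
      rw [Real.norm_of_nonneg (gram_apply_self_re_nonneg _ j), hsub]
      exact gram_sub_apply_self_re_le _ _ j
    · simp only [hu0, J_form_re, htop]
      simp
  ext k j
  have h1 := key j
  rw [gram_apply_self_re, hu0, Finset.sum_eq_zero_iff_of_nonneg (fun _ _ => by positivity)] at h1
  have h2 := h1 k (Finset.mem_univ k)
  rw [rowβ_mul_apply, htop, mul_zero, zero_add, sq_eq_zero_iff, norm_eq_zero] at h2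
  have h3 : -Complex.I * (ψ z k j - χ z k j) = 0 := by
    rw [← h2]
    simp [F]
    ring
  exact sub_eq_zero.1 ((mul_eq_zero.1 h3).resolve_left (by simp))

end Energy

end CanonicalSystem

namespace CanonicalSystem

/-! ### Explicit Weyl functions for diagonals `e` with `e² = d²` -/

section WeylFunctions

variable {n p : ℕ} (d e : Fin p → ℝ) (α : Matrix (Fin n) (Fin n) ℂ)
  (Λ₁ Λ₂ : Matrix (Fin n) (Fin p) ℂ) {x : ℝ} {z : ℂ}

theorem det_γ_sub_ne_zero (hz : z ∉ spectrum ℂ (γ e α Λ₁ Λ₂)) :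
    (γ e α Λ₁ Λ₂ - z • (1 : Matrix (Fin n) (Fin n) ℂ)).det ≠ 0 := by
  rw [spectrum.notMem_iff, Algebra.algebraMap_eq_smul_one] at hz
  have h := hz.neg
  rw [neg_sub, Matrix.isUnit_iff_isUnit_det] at h
  exact h.ne_zero

theorem φ_differentiableOn (i j : Fin p) :
    DifferentiableOn ℂ (fun z => φ e α Λ₁ Λ₂ z i j) (spectrum ℂ (γ e α Λ₁ Λ₂))ᶜ := by
  intro z hz
  have h := fun a b => differentiableWithinAt_inv (𝕜 := ℂ) (s := (spectrum ℂ (γ e α Λ₁ Λ₂))ᶜ)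
    (A := fun z => γ e α Λ₁ Λ₂ - z • (1 : Matrix (Fin n) (Fin n) ℂ)) (x := z)
    (fun i j => ((differentiableWithinAt_const _).sub
      (differentiableWithinAt_id.mul_const _))) (det_γ_sub_ne_zero e α Λ₁ Λ₂ hz) a b
  simp only [φ, Matrix.add_apply, Matrix.mul_apply]
  exact (differentiableWithinAt_const _).add (DifferentiableWithinAt.fun_sum fun a _ =>
    (DifferentiableWithinAt.fun_sum fun b _ => (h b a).const_mul _).mul_const _)

theorem spectrum_γ_inter_upperHalf (he : ∀ i, e i ≤ 0) (hα : α - αᴴ =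
      Complex.I • (Matrix.fromCols Λ₁ Λ₂ * J p * (Matrix.fromCols Λ₁ Λ₂)ᴴ)) :
    spectrum ℂ (γ e α Λ₁ Λ₂) ∩ upperHalf = ∅ := by
  refine eq_empty_iff_forall_notMem.2 fun z hz => ?_
  obtain ⟨hz, hzi⟩ := hz
  rw [spectrum.mem_iff, Algebra.algebraMap_eq_smul_one, Matrix.isUnit_iff_isUnit_det,
    isUnit_iff_ne_zero, not_not, ← Matrix.exists_mulVec_eq_zero_iff] at hz
  obtain ⟨v, hv0, hv⟩ := hz
  -- The eigenvector is viewed as a one-column matrix so that the matrix identity for `γ - γ^*`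
  -- applies.
  let K : Matrix (Fin n) Unit ℂ := Matrix.of fun i _ => v i
  have hK : γ e α Λ₁ Λ₂ * K = z • K := by
    ext i j
    have h := congrFun hv i
    rw [Matrix.sub_mulVec, Matrix.smul_mulVec, Matrix.one_mulVec] at h
    exact (sub_eq_zero.1 h).symm
  have h1 : Kᴴ * ((γ e α Λ₁ Λ₂ - (γ e α Λ₁ Λ₂)ᴴ) * K) = (z - starRingEnd ℂ z) • (Kᴴ * K) := by
    rw [Matrix.sub_mul, Matrix.mul_sub, ← Matrix.mul_assoc Kᴴ (γ e α Λ₁ Λ₂)ᴴ,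
      ← Matrix.conjTranspose_mul, hK, Matrix.conjTranspose_smul, Matrix.mul_smul, Matrix.smul_mul,
      sub_smul, Complex.star_def]
  have h2 : Kᴴ * ((Complex.I • (Λ₂ * D e * Λ₂ᴴ)) * K) =
      Complex.I • ((Λ₂ᴴ * K)ᴴ * (D e * (Λ₂ᴴ * K))) := by
    simp only [Matrix.conjTranspose_mul, Matrix.conjTranspose_conjTranspose, Matrix.smul_mul,
      Matrix.mul_smul, Matrix.mul_assoc]
  rw [γ_sub_conjTranspose α Λ₁ Λ₂ e hα, h2] at h1
  -- Both sides are purely imaginary: `∑ e_k |(Λ₂^* K)_k|² = 2 Im z ‖K‖²`, nonpositive on the left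
  -- and positive on the right.
  have h3 := congrArg Complex.im (congrFun₂ h1 () ())
  have h4 : ((Λ₂ᴴ * K)ᴴ * (D e * (Λ₂ᴴ * K))) () () =
      ((∑ k, e k * ‖(Λ₂ᴴ * K) k ()‖ ^ 2 : ℝ) : ℂ) := by
    rw [Matrix.mul_apply, Complex.ofReal_sum]
    refine Finset.sum_congr rfl fun k _ => ?_
    rw [D, Matrix.diagonal_mul, Matrix.conjTranspose_apply, Complex.ofReal_mul,
      ← Complex.normSq_eq_norm_sq, ← Complex.mul_conj, Complex.star_def]
    ring
  rw [Matrix.smul_apply, Matrix.smul_apply, h4, gram_apply_self, Complex.sub_conj] at h3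
  simp only [smul_eq_mul, Complex.mul_im, Complex.mul_re, Complex.I_re, Complex.I_im,
    Complex.ofReal_re, Complex.ofReal_im, one_mul, mul_zero, mul_one, zero_add, add_zero,
    sub_zero] at h3
  have h5 : ∑ k, e k * ‖(Λ₂ᴴ * K) k ()‖ ^ 2 ≤ 0 :=
    Finset.sum_nonpos fun k _ => mul_nonpos_of_nonpos_of_nonneg (he k) (by positivity)
  have h6 : 0 < ∑ k, ‖K k ()‖ ^ 2 := by
    obtain ⟨i, hi⟩ := Function.ne_iff.1 hv0
    exact Finset.sum_pos' (fun _ _ => by positivity)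
      ⟨i, Finset.mem_univ i, pow_pos (norm_pos_iff.2 hi) 2⟩
  have h7 : 0 < z.im := hzi
  have h8 := mul_pos h7 h6
  linarith

/-- The column `[I; -D/2]`. -/
noncomputable def colNeg : Matrix (Fin p ⊕ Fin p) (Fin p) ℂ :=
  Matrix.fromRows 1 (-(1 / 2 : ℂ) • D e)

theorem fromCols_mul_colNeg : Matrix.fromCols Λ₁ Λ₂ * colNeg e = Psi₂Const e Λ₁ Λ₂ := by
  rw [colNeg, Matrix.fromCols_mul_fromRows, Psi₂Const, Matrix.mul_smul, Matrix.mul_one, neg_smul,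
    sub_eq_add_neg]

/-- `diag{(d_i - e_i) / 2}`. -/
noncomputable def halfDiff : Matrix (Fin p) (Fin p) ℂ :=
  Matrix.diagonal fun i => ((((d i - e i) / 2 : ℝ)) : ℂ)

/-- `[D/2 I][I; -E/2] = (D - E)/2`, so the upper blocks agree, and the lower ones agree exactly when
`(D + E)(D - E) = 0`. This is where `e² = d²` enters. -/
theorem H₀_mul_colNeg (he : ∀ i, e i ^ 2 = d i ^ 2) :
    J p * (H₀ d * colNeg e) = colNeg e * halfDiff d e := by
  have h1 : rowβ d * colNeg e = halfDiff d e := by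
    rw [rowβ, colNeg, Matrix.fromCols_mul_fromRows, Matrix.mul_one, Matrix.one_mul, halfDiff, D, D,
      ← Matrix.diagonal_smul, ← Matrix.diagonal_smul, Matrix.diagonal_add]
    congr 1
    ext i
    simp
    ring
  rw [H₀_eq, Matrix.mul_assoc, h1, ← Matrix.mul_assoc, J_mul_rowβ, colNeg, Matrix.fromRows_mul,
    Matrix.fromRows_mul]
  congr 1
  rw [halfDiff, D, D, ← Matrix.diagonal_smul, ← Matrix.diagonal_smul, Matrix.diagonal_mul_diagonal,
    Matrix.diagonal_mul_diagonal]
  congr 1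
  ext i
  have h : (e i : ℂ) ^ 2 = (d i : ℂ) ^ 2 := by exact_mod_cast he i
  simp
  linear_combination (-1 / 4 : ℂ) * h

/-- `exp(i x z diag{(d_i - e_i) / 2})`. -/
noncomputable def expDiff (z : ℂ) (x : ℝ) : Matrix (Fin p) (Fin p) ℂ :=
  Matrix.diagonal fun i => Complex.exp ((Complex.I * z * (((d i - e i) / 2 : ℝ) : ℂ)) * (x : ℂ))

theorem expDiff_zero : expDiff d e z 0 = 1 := by simp [expDiff]

theorem expDiff_hasEntryDeriv :
    HasEntryDeriv (expDiff d e z) ((Complex.I * z) • (halfDiff d e * expDiff d e z x)) x := by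
  intro i j
  rw [halfDiff, expDiff, Matrix.diagonal_mul_diagonal, Matrix.smul_apply]
  by_cases hij : i = j
  · subst hij
    have h := ((Complex.ofRealCLM.hasDerivAt (x := x)).const_mul
      (Complex.I * z * (((d i - e i) / 2 : ℝ) : ℂ))).cexp
    simp only [Complex.ofRealCLM_apply, Complex.ofReal_one, mul_one] at h
    simp only [expDiff, Matrix.diagonal_apply_eq]
    refine h.hasDerivWithinAt.congr_deriv ?_
    rw [smul_eq_mul]
    ring
  · simp only [expDiff, Matrix.diagonal_apply_ne _ hij, smul_zero]
    exact hasDerivWithinAt_const _ _ _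

theorem colNeg_form_re (X : Matrix (Fin p) (Fin p) ℂ) (j : Fin p) :
    (((colNeg e * X)ᴴ * (J p * (colNeg e * X))) j j).re = -∑ k, e k * ‖X k j‖ ^ 2 := by
  rw [J_form_re, ← Finset.sum_neg_distrib]
  refine Finset.sum_congr rfl fun k _ => ?_
  have h1 : (colNeg e * X) (Sum.inl k) j = X k j := by
    rw [colNeg, Matrix.fromRows_mul, Matrix.fromRows_apply_inl, Matrix.one_mul]
  have h2 : (colNeg e * X) (Sum.inr k) j = ((-(e k / 2) : ℝ) : ℂ) * X k j := by
    rw [colNeg, Matrix.fromRows_mul, Matrix.fromRows_apply_inr, Matrix.smul_mul, D,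
      Matrix.smul_apply, Matrix.diagonal_mul, smul_eq_mul]
    push_cast
    ring
  rw [h1, h2, Complex.re_ofReal_mul, Complex.im_ofReal_mul, ← Complex.normSq_eq_norm_sq,
    Complex.normSq_apply]
  ring

open scoped ComplexOrder in
theorem Sig_inv_form_re_nonneg {k : Type*} [Finite k] (K : Matrix (Fin n) k ℂ) (hx : 0 ≤ x) (j : k) :
    0 ≤ ((Kᴴ * ((Sig d α Λ₁ Λ₂ x)⁻¹ * K)) j j).re := by
  have h := ((Sig_posDef d α Λ₁ Λ₂ hx).inv.posSemidef.conjTranspose_mul_mul_same K).diag_nonneg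
    (i := j)
  rw [Matrix.mul_assoc] at h
  exact (Complex.nonneg_iff.1 h).1

/-- `φ` built from a diagonal matrix with entries `e_i = ± d_i` is a Weyl function of the system
built from `D`, provided that all `e_i ≤ 0` or `e = d`. -/
theorem isWeylOn_φ (he : ∀ i, e i ^ 2 = d i ^ 2) (hed : e = d ∨ ∀ i, e i ≤ 0) (hα : α - αᴴ =
      Complex.I • (Matrix.fromCols Λ₁ Λ₂ * J p * (Matrix.fromCols Λ₁ Λ₂)ᴴ)) :
    IsWeylOn (Ham d α Λ₁ Λ₂) (φ e α Λ₁ Λ₂) (upperHalf \ spectrum ℂ (γ e α Λ₁ Λ₂)) := by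
  refine ⟨fun i j => (φ_differentiableOn e α Λ₁ Λ₂ i j).mono fun z hz => hz.2, ?_⟩
  rintro z ⟨hz, hzs⟩ i j
  have hdet := det_γ_sub_ne_zero e α Λ₁ Λ₂ hzs
  -- `K₀` and `c` solve two conditions at `x = 0`: `α K₀ = z K₀ + Λ(0) [I; -E/2] c`, and upper block
  -- `c - i Λ₂^* K₀ = I` of `y(0)`. Eliminating `c` gives `(γ - z) K₀ = Ψ₂`.
  obtain ⟨K₀, hK₀def⟩ : ∃ K₀ : Matrix (Fin n) (Fin p) ℂ, K₀ =
    (γ e α Λ₁ Λ₂ - z • (1 : Matrix (Fin n) (Fin n) ℂ))⁻¹ * Psi₂Const e Λ₁ Λ₂ := ⟨_, rfl⟩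
  let c : Matrix (Fin p) (Fin p) ℂ := 1 + Complex.I • (Λ₂ᴴ * K₀)
  let g : ℝ → Matrix (Fin p ⊕ Fin p) (Fin p) ℂ := fun x => colNeg e * (expDiff d e z x * c)
  have hK₀ : (γ e α Λ₁ Λ₂ - z • (1 : Matrix (Fin n) (Fin n) ℂ)) * K₀ = Psi₂Const e Λ₁ Λ₂ :=
    hK₀def ▸ Matrix.mul_nonsing_inv_cancel_left _ _ (isUnit_iff_ne_zero.2 hdet)
  have hg : ∀ x, HasEntryDeriv g ((Complex.I * z) • (J p * (H₀ d * g x))) x := fun x =>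
    (((expDiff_hasEntryDeriv d e).mul_const c).const_mul (colNeg e)).congr_deriv (by
      have h := H₀_mul_colNeg d e he
      simp only [g, Matrix.smul_mul, Matrix.mul_smul]
      rw [← Matrix.mul_assoc (H₀ d), ← Matrix.mul_assoc (J p), h]
      simp only [Matrix.mul_assoc])
  have hgc : ContinuousOn g (Ici 0) := continuousOn_of_hasEntryDeriv fun x _ => hg x
  have hfc : ContinuousOn (fun x => -Complex.I • (Lam d α Λ₁ Λ₂ x * (J p * (H₀ d * g x))))
      (Ici 0) :=
    (continuousOn_mul (Lam_spec d α Λ₁ Λ₂).continuousOn (continuousOn_mul continuousOn_const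
      (continuousOn_mul continuousOn_const hgc))).fun_const_smul (-Complex.I)
  obtain ⟨K, hK0, hK⟩ := exists_primitive hfc K₀
  have hg0 : g 0 = colNeg e * c := by simp only [g, expDiff_zero, Matrix.one_mul]
  have hKx : ∀ x, 0 ≤ x → α * K x = z • K x + Lam d α Λ₁ Λ₂ x * g x := by
    intro x hx
    refine eq_of_hasEntryDeriv (fun y hy => (hK y hy).const_mul α) (fun y hy =>
      (((hK y hy).const_smul z).add ((Lam_hasEntryDeriv d α Λ₁ Λ₂ hy).mul (hg y))).congr_deriv ?_)
      ?_ hx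
    -- Both sides have derivative `-i α Λ J H₀ g`: the terms with `z` coming from `K'` and `g'`
    -- cancel.
    · simp only [Matrix.smul_mul, Matrix.mul_smul, Matrix.mul_assoc]
      module
    · rw [hK0, hg0, Lam_zero, ← Matrix.mul_assoc, fromCols_mul_colNeg, Matrix.mul_add,
        Matrix.mul_one]
      simp only [γ, Matrix.sub_mul, Matrix.smul_mul, Matrix.one_mul, Matrix.mul_assoc] at hK₀
      rw [sub_sub, sub_eq_iff_eq_add] at hK₀
      rw [hK₀, Matrix.mul_smul]
      abel
  let y : ℝ → Matrix (Fin p ⊕ Fin p) (Fin p) ℂ := fun x => g x - Complex.I •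
    (J p * ((Lam d α Λ₁ Λ₂ x)ᴴ * ((Sig d α Λ₁ Λ₂ x)⁻¹ * K x)))
  have hy : ∀ x, 0 ≤ x → HasEntryDeriv y
      (((Complex.I * z) • (J p * H₀ d) - q₀ d α Λ₁ Λ₂ x) * y x) x := fun x hx =>
    darboux_hasEntryDeriv d α Λ₁ Λ₂ hα (hg x) (hK x hx) (hKx x hx) hx
  have hy0 : y 0 = Matrix.fromRows 1 (-Complex.I • φ e α Λ₁ Λ₂ z) := by
    have h1 : φ e α Λ₁ Λ₂ z = -(Complex.I / 2) • D e + (Psi₁Zero e Λ₁ Λ₂)ᴴ * K₀ := by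
      rw [φ, Matrix.mul_assoc, hK₀def]
    simp only [y, hg0, hK0, Lam_zero, Sig_zero, inv_one, Matrix.one_mul]
    rw [Matrix.conjTranspose_fromCols_eq_fromRows_conjTranspose, Matrix.fromRows_mul,
      J_mul_fromRows, colNeg, Matrix.fromRows_mul, Matrix.one_mul, h1, Psi₁Zero]
    ext a b
    rcases a with a | a
    · simp [c]
    · simp only [c, Matrix.sub_apply, Matrix.smul_apply, Matrix.fromRows_apply_inr,
        Matrix.smul_mul, Matrix.mul_add, Matrix.mul_one, Matrix.mul_smul, Matrix.add_apply,
        Matrix.conjTranspose_add, Matrix.conjTranspose_smul, Matrix.conjTranspose_mul,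
        D_conjTranspose, Matrix.add_mul, Matrix.mul_assoc, smul_eq_mul, Complex.star_def, map_div₀,
        map_one, map_ofNat]
      linear_combination (-(1 / 2 : ℂ) * D e a b) * Complex.I_mul_I
  have hyw : ∀ x, 0 ≤ x → v₀ d α Λ₁ Λ₂ x * (fundamentalSolution (Ham d α Λ₁ Λ₂) z x *
      (Matrix.fromRows 1 (-Complex.I • φ e α Λ₁ Λ₂ z) : Matrix (Fin p ⊕ Fin p) (Fin p) ℂ)) = y x :=
    fun x hx => eq_of_linear_ode (continuousOn_const.sub (q₀_continuousOn d α Λ₁ Λ₂))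
      (fun t ht => v₀_fundamentalSolution_hasEntryDeriv d α Λ₁ Λ₂ z _ ht) hy
      (by rw [hy0, v₀_zero, (fundamentalSolution_spec (Ham_continuousOn d α Λ₁ Λ₂) z).1,
        Matrix.one_mul, Matrix.one_mul]) hx
  -- The minimum serves both cases: `0` bounds the energy of `g` when `e ≤ 0`, and for `e = d` the
  -- exponential is `1`, so that energy keeps its initial value.
  have hlow : ∀ j x, 0 ≤ x → min 0 (-∑ k, e k * ‖c k j‖ ^ 2) ≤ (((y x)ᴴ * (J p * y x)) j j).re := by
    intro j x hx
    have h1 := darboux_energy d α Λ₁ Λ₂ hα (hKx x hx) hx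
    have h2 := Sig_inv_form_re_nonneg d α Λ₁ Λ₂ (K x) hx j
    have h3 : min 0 (-∑ k, e k * ‖c k j‖ ^ 2) ≤ (((g x)ᴴ * (J p * g x)) j j).re := by
      rw [colNeg_form_re]
      rcases hed with rfl | hneg
      · refine (min_le_right _ _).trans (le_of_eq ?_)
        simp [expDiff]
      · exact (min_le_left _ _).trans (neg_nonneg.2 (Finset.sum_nonpos fun k _ =>
          mul_nonpos_of_nonpos_of_nonneg (hneg k) (by positivity)))
    have h4 : (((y x)ᴴ * (J p * y x)) j j).re = (((g x)ᴴ * (J p * g x)) j j).re +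
        2 * z.im * (((K x)ᴴ * ((Sig d α Λ₁ Λ₂ x)⁻¹ * K x)) j j).re := by
      simp only [y, h1, Matrix.add_apply, Matrix.smul_apply, smul_eq_mul, Complex.add_re,
        Complex.re_ofReal_mul]
    have hz' : 0 < z.im := hz
    have h5 := mul_nonneg hz'.le h2
    rw [h4]
    linarith
  refine (energy_integrableOn d α Λ₁ Λ₂ hz hy _ hlow i j).congr_fun (fun x hx => ?_)
    measurableSet_Ici
  simp only [weylIntegrand_eq, hyw x hx]

/-! ### The hatted objects as the case `e = -|d|` -/

theorem absD_eq : absD d = -D fun i => -|d i| := by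
  rw [absD, D, Matrix.diagonal_neg]
  congr 1
  ext i
  simp

theorem PsiHat₂_eq : PsiHat₂ d Λ₁ Λ₂ = Psi₂Const (fun i => -|d i|) Λ₁ Λ₂ := by
  rw [PsiHat₂, Psi₂Const, absD_eq, Matrix.mul_neg, smul_neg, sub_eq_add_neg]

theorem PsiHat₁Zero_eq : PsiHat₁Zero d Λ₁ Λ₂ = Psi₁Zero (fun i => -|d i|) Λ₁ Λ₂ := by
  rw [PsiHat₁Zero, Psi₁Zero, absD_eq, Matrix.mul_neg, smul_neg, sub_neg_eq_add]

theorem γhat_eq : γhat d α Λ₁ Λ₂ = γ (fun i => -|d i|) α Λ₁ Λ₂ := by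
  rw [γhat, γ, PsiHat₂_eq]

theorem φhat_eq : φhat d α Λ₁ Λ₂ = φ (fun i => -|d i|) α Λ₁ Λ₂ := by
  ext1 z
  rw [φhat, φ, PsiHat₂_eq, PsiHat₁Zero_eq, γhat_eq, absD_eq, smul_neg, neg_smul]

/-- Since `Ψ̂₂ - Ψ̂₁(0) = Λ₂ |D|`, the factor `|D|⁻¹` cancels one `|D|`, and the claim is the
identity for `γ` with `e = -|d|`. -/
theorem γhat_conjTranspose_sub (hd : ∀ i, d i ≠ 0) (hα : α - αᴴ =
      Complex.I • (Matrix.fromCols Λ₁ Λ₂ * J p * (Matrix.fromCols Λ₁ Λ₂)ᴴ)) :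
    (γhat d α Λ₁ Λ₂)ᴴ - γhat d α Λ₁ Λ₂ =
      Complex.I • ((PsiHat₂ d Λ₁ Λ₂ - PsiHat₁Zero d Λ₁ Λ₂) * (absD d)⁻¹ *
        (PsiHat₂ d Λ₁ Λ₂ - PsiHat₁Zero d Λ₁ Λ₂)ᴴ) := by
  have h1 : PsiHat₂ d Λ₁ Λ₂ - PsiHat₁Zero d Λ₁ Λ₂ = Λ₂ * absD d := by
    rw [PsiHat₂, PsiHat₁Zero]
    module
  have h2 : IsUnit (absD d).det := by
    rw [absD, Matrix.det_diagonal, isUnit_iff_ne_zero, Finset.prod_ne_zero_iff]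
    intro i _
    exact_mod_cast abs_ne_zero.2 (hd i)
  rw [h1, Matrix.mul_assoc Λ₂, Matrix.mul_nonsing_inv _ h2, Matrix.mul_one,
    Matrix.conjTranspose_mul, ← neg_sub, γhat_eq, γ_sub_conjTranspose α Λ₁ Λ₂ _ hα, absD_eq,
    Matrix.conjTranspose_neg, D_conjTranspose]
  simp only [Matrix.neg_mul, Matrix.mul_neg, Matrix.mul_assoc, smul_neg]

end WeylFunctions

end CanonicalSystem

theorem mainTheorem5 {n p : ℕ} (d : Fin p → ℝ) (hd : ∀ i, d i ≠ 0)
    (α : Matrix (Fin n) (Fin n) ℂ) (Λ₁ Λ₂ : Matrix (Fin n) (Fin p) ℂ)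
    (hα : α - αᴴ =
      Complex.I • (Matrix.fromCols Λ₁ Λ₂ * J p * (Matrix.fromCols Λ₁ Λ₂)ᴴ)) :
    -- the values of `Ψ₁` and `Ψ₂`
    (Psi₁ d α Λ₁ Λ₂ 0 = Psi₁Zero d Λ₁ Λ₂ ∧
      ∀ x : ℝ, 0 ≤ x → Psi₂ d α Λ₁ Λ₂ x = Psi₂Const d Λ₁ Λ₂) ∧
    -- `φ` and `φ̂` are Weyl functions; `φ̂` has no singularities in the upper half-plane
    IsWeylOn (Ham d α Λ₁ Λ₂) (φ d α Λ₁ Λ₂) (upperHalf \ spectrum ℂ (γ d α Λ₁ Λ₂)) ∧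
    spectrum ℂ (γhat d α Λ₁ Λ₂) ∩ upperHalf = ∅ ∧
    IsWeylFunction (Ham d α Λ₁ Λ₂) (φhat d α Λ₁ Λ₂) ∧
    -- the case `D < 0`
    ((∀ i, d i < 0) →
      φ d α Λ₁ Λ₂ = φhat d α Λ₁ Λ₂ ∧
      spectrum ℂ (γ d α Λ₁ Λ₂) ∩ upperHalf = ∅ ∧
      IsWeylFunction (Ham d α Λ₁ Λ₂) (φ d α Λ₁ Λ₂) ∧
      ∀ S ⊆ upperHalf, ∀ ψ : ℂ → Matrix (Fin p) (Fin p) ℂ,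
        IsWeylOn (Ham d α Λ₁ Λ₂) ψ S → Set.EqOn ψ (φ d α Λ₁ Λ₂) S) ∧
    -- the matrix identities
    γ d α Λ₁ Λ₂ - (γ d α Λ₁ Λ₂)ᴴ = Complex.I • (Λ₂ * D d * Λ₂ᴴ) ∧
    (γhat d α Λ₁ Λ₂)ᴴ - γhat d α Λ₁ Λ₂ =
      Complex.I • ((PsiHat₂ d Λ₁ Λ₂ - PsiHat₁Zero d Λ₁ Λ₂) * (absD d)⁻¹ *
        (PsiHat₂ d Λ₁ Λ₂ - PsiHat₁Zero d Λ₁ Λ₂)ᴴ) := by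

  have habs : ∀ i, (-|d i|) ^ 2 = d i ^ 2 := fun i => by rw [neg_sq, sq_abs]
  have hnonpos : ∀ i, -|d i| ≤ 0 := fun i => neg_nonpos.2 (abs_nonneg _)
  have hspec : spectrum ℂ (γhat d α Λ₁ Λ₂) ∩ upperHalf = ∅ := by
    rw [γhat_eq]
    exact spectrum_γ_inter_upperHalf _ α Λ₁ Λ₂ hnonpos hα
  have hhat : IsWeylFunction (Ham d α Λ₁ Λ₂) (φhat d α Λ₁ Λ₂) := by
    have h := isWeylOn_φ d _ α Λ₁ Λ₂ habs (Or.inr hnonpos) hα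
    rwa [← φhat_eq, ← γhat_eq, ((disjoint_iff_inter_eq_empty.2 hspec).symm).sdiff_eq_left] at h
  refine ⟨⟨Psi₁_zero d α Λ₁ Λ₂, fun x hx => Psi₂_eq d α Λ₁ Λ₂ hx⟩,
    isWeylOn_φ d d α Λ₁ Λ₂ (fun _ => rfl) (Or.inl rfl) hα, hspec, hhat, fun hneg => ?_,
    γ_sub_conjTranspose α Λ₁ Λ₂ d hα, γhat_conjTranspose_sub d α Λ₁ Λ₂ hd hα⟩
  -- For negative `D` the two admissible choices of `e` coincide, so uniqueness compares any Weyl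
  -- function with `φ̂`.
  have hd' : (fun i => -|d i|) = d := funext fun i => by rw [abs_of_neg (hneg i), neg_neg]
  have hφ : φ d α Λ₁ Λ₂ = φhat d α Λ₁ Λ₂ := by rw [φhat_eq, hd']
  have hγ : γ d α Λ₁ Λ₂ = γhat d α Λ₁ Λ₂ := by rw [γhat_eq, hd']
  rw [hφ, hγ]
  exact ⟨rfl, hspec, hhat, fun S hS ψ hψ z hz =>
    weyl_value_unique d α Λ₁ Λ₂ hneg (hS hz) (hψ.2 z hz) (hhat.2 z (hS hz))⟩
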